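/- **Conventions.** A *weighted graph* $(E,\omega)$ consists of countable sets $E^0$ (vertices) and $E^{\mathrm{st}}$ (structured edges), maps $s,r:E^{\mathrm{st}}\to E^0$ and a weight map $\omega:E^{\mathrm{st}}\to\{1,2,\dots\}$; it is assumed row-finite, i.e. $s^{-1}(v)$ is finite for every $v\in E^0$. Each $\alpha\in E^{\mathrm{st}}$ gives $\omega(\alpha)$ edges $\alpha_1,\dots,\alpha_{\omega(\alpha)}$. A vertex $v$ is a sink if $s^{-1}(v)=\emptyset$; otherwise $\omega(v)=\max\{\omega(\alpha)\mid s(\alpha)=v\}$. Let $R$ be a unital, not necessarily commutative, ring. The *weighted Leavitt path algebra* $L_R(E,\omega)$ is the (not necessarily unital) $R$-ring generated by the symbols $v$ ($v\in E^0$) and $\alpha_i,\alpha_i^*$ ($\alpha\in E^{\mathrm{st}}$, $1\le i\le\omega(\alpha)$), the elements of $R$ commuting with the generators, subject to the relations 1. $vw=\delta_{vw}v$ for $v,w\in E^0$; 2. $s(\alpha)\alpha_i=\alpha_i=\alpha_i r(\alpha)$ and $r(\alpha)\alpha_i^*=\alpha_i^*=\alpha_i^*s(\alpha)$ for $\alpha\in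 E^{\mathrm{st}}$, $1\le i\le\omega(\alpha)$; 3. $\sum_{s(\alpha)=v}\alpha_i\alpha_j^*=\delta_{ij}v$ for every $v\in E^0$ that is not a sink and $1\le i,j\le\omega(v)$; 4. $\sum_{1\le i\le\max\{\omega(\alpha),\omega(\beta)\}}\alpha_i^*\beta_i=\delta_{\alpha\beta}r(\alpha)$ for $\alpha,\beta\in E^{\mathrm{st}}$; where in (3) and (4) $\alpha_i$ and $\alpha_i^*$ are read as $0$ if $i>\omega(\alpha)$. A *domain* is a nonzero ring without zero divisors. A *rose* is a weighted graph with exactly one vertex; its structured edges are its *petals*. A weighted graph is *unweighted* if $\omega(\alpha)=1$ for all $\alpha\in E^{\mathrm{st}}$. An *LV-rose* is a rose with at least one petal such that $\omega(\alpha)\ge 2$ for all $\alpha\in E^{\mathrm{st}}$ and at least two petals have the maximal weight $\omega(v)$, where $v$ is the vertex. For $n\ge1$ and $k\ge 0$, the *Leavitt algebra* $L_R(n,n+k)$ is the unital $R$-ring generated by the entries of an $n\times(n+k)$ matrix $Y$ and of an $(n+k)\times n$ matrix $X$ of symbols commuting with $R$, subject to $YX=I_n$ and $XY=I_{n+k}$.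 **Theorem.** Let $R$ be a unital ring. (a) For every weighted graph $(E,\omega)$, the ring $L_R(E,\omega)$ is a domain if and only if $R$ is a domain and $(E,\omega)$ is either an unweighted rose with at most one petal or an LV-rose. (b) If $R$ is a domain, then $L_R(n,n+k)$ is a domain for all $n\ge 2$ and $k\ge 0$. -/

import Mathlib

universe u v w

/-- A (countable, row-finite) weighted graph: vertices, structured edges, source and range maps,
and a weight map with positive values. A structured edge `α` of weight `k` stands for `k` edges
`α_1, …, α_k`, which are indexed here by `Fin k`, that is, from `0` to `k - 1`. -/
structure WeightedGraph where
  /-- the vertices -/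
  Vertex : Type u
  /-- the structured edges -/
  StEdge : Type v
  countable_vertex : Countable Vertex
  countable_stEdge : Countable StEdge
  /-- the source of a structured edge -/
  source : StEdge → Vertex
  /-- the range of a structured edge -/
  range : StEdge → Vertex
  /-- the weight of a structured edge -/
  weight : StEdge → ℕ
  weight_pos : ∀ α, 0 < weight α
  rowFinite : ∀ v, {α | source α = v}.Finite

namespace WeightedGraph

variable (E : WeightedGraph.{u, v})

/-- The finite set `s⁻¹(v)` of structured edges emitted by `v`. -/
noncomputable def outEdges (v : E.Vertex) : Finset E.StEdge := (E.rowFinite v).toFinset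

/-- A vertex is a sink if it emits no structured edge. -/
def IsSink (v : E.Vertex) : Prop := ∀ α, E.source α ≠ v

/-- `ω(v)`, the maximal weight of a structured edge emitted by `v` (it is `0` if `v` is a sink). -/
noncomputable def maxWeight (v : E.Vertex) : ℕ := (E.outEdges v).sup E.weight

/-- The alphabet `X = E⁰ ∪ E¹ ∪ (E¹)*`. -/
inductive Gen : Type (max u v)
  | vertex (v : E.Vertex) : Gen
  | edge (α : E.StEdge) (i : Fin (E.weight α)) : Gen
  | ghost (α : E.StEdge) (i : Fin (E.weight α)) : Gen

variable {E} in
/-- The source of a generator; `α_i*` runs backwards. -/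
def Gen.src : E.Gen → E.Vertex
  | .vertex v => v
  | .edge α _ => E.source α
  | .ghost α _ => E.range α

variable {E} in
/-- The range of a generator. -/
def Gen.tgt : E.Gen → E.Vertex
  | .vertex v => v
  | .edge α _ => E.range α
  | .ghost α _ => E.source α

/-- `E.GenPath u v`: there is a generalised path from `u` to `v`, that is, a finite sequence of
composable generators. -/
def GenPath : E.Vertex → E.Vertex → Prop :=
  Relation.ReflTransGen fun u v => ∃ x : E.Gen, x.src = u ∧ x.tgt = v

/-- There is exactly one connected component: the vertex set is non-empty and any two vertices are
joined by a generalised path. -/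
def IsConnected : Prop := Nonempty E.Vertex ∧ ∀ u v, E.GenPath u v

/-- A rose is a weighted graph with exactly one vertex; its structured edges are its petals. -/
def IsRose : Prop := Nat.card E.Vertex = 1

/-- All weights are equal to `1`. -/
def IsUnweighted : Prop := ∀ α, E.weight α = 1

/-- An LV-graph: it has an edge, is connected, all weights are at least two, and at each vertex
which is not a sink the maximal weight is attained by at least two structured edges. -/
structure IsLVGraph : Prop where
  nonempty_stEdge : Nonempty E.StEdge
  connected : E.IsConnected
  two_le_weight : ∀ α, 2 ≤ E.weight α
  two_le_card : ∀ v, ¬ E.IsSink v →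
    2 ≤ ((E.outEdges v).filter fun α => E.weight α = E.maxWeight v).card

/-- An LV-rose is an LV-graph with exactly one vertex. -/
def IsLVRose : Prop := E.IsLVGraph ∧ E.IsRose

end WeightedGraph

/-- The free `R`-ring `R⟨X⟩`: the free left `R`-module on the non-empty words over `X`, with the
multiplication given by `(r x) (s y) = (r s) (x y)`. It has no unit in general. -/
abbrev FreeRRing (R : Type w) [Ring R] (X : Type u) : Type (max u w) :=
  MonoidAlgebra R (FreeSemigroup X)

namespace WeightedGraph

variable (R : Type w) [Ring R] (E : WeightedGraph.{u, v})

/-- A generator, as an element of `R⟨X⟩`. -/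
noncomputable def gen (x : E.Gen) : FreeRRing R E.Gen :=
  MonoidAlgebra.single (FreeSemigroup.of x) 1

/-- The vertex `v` in `R⟨X⟩`. -/
noncomputable def vtx (v : E.Vertex) : FreeRRing R E.Gen := E.gen R (.vertex v)

/-- The edge `α_{i+1}` in `R⟨X⟩`, which is zero if `i + 1 > ω(α)`. -/
noncomputable def edg (α : E.StEdge) (i : ℕ) : FreeRRing R E.Gen :=
  if h : i < E.weight α then E.gen R (.edge α ⟨i, h⟩) else 0

/-- The ghost edge `α_{i+1}*` in `R⟨X⟩`, which is zero if `i + 1 > ω(α)`. -/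
noncomputable def gst (α : E.StEdge) (i : ℕ) : FreeRRing R E.Gen :=
  if h : i < E.weight α then E.gen R (.ghost α ⟨i, h⟩) else 0

open Classical in
/-- The defining relations of the weighted Leavitt path algebra, as pairs (left-hand side,
right-hand side). -/
inductive Rel : FreeRRing R E.Gen → FreeRRing R E.Gen → Prop
  | vertex_mul_vertex (v w : E.Vertex) :
      Rel (E.vtx R v * E.vtx R w) (if v = w then E.vtx R v else 0)
  | source_mul_edge (α : E.StEdge) (i : ℕ) (hi : i < E.weight α) :
      Rel (E.vtx R (E.source α) * E.edg R α i) (E.edg R α i)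
  | edge_mul_range (α : E.StEdge) (i : ℕ) (hi : i < E.weight α) :
      Rel (E.edg R α i * E.vtx R (E.range α)) (E.edg R α i)
  | range_mul_ghost (α : E.StEdge) (i : ℕ) (hi : i < E.weight α) :
      Rel (E.vtx R (E.range α) * E.gst R α i) (E.gst R α i)
  | ghost_mul_source (α : E.StEdge) (i : ℕ) (hi : i < E.weight α) :
      Rel (E.gst R α i * E.vtx R (E.source α)) (E.gst R α i)
  | edge_mul_ghost (v : E.Vertex) (i j : ℕ) (hi : i < E.maxWeight v) (hj : j < E.maxWeight v) :
      Rel (∑ α ∈ E.outEdges v, E.edg R α i * E.gst R α j) (if i = j then E.vtx R v else 0)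
  | ghost_mul_edge (α β : E.StEdge) :
      Rel (∑ i ∈ Finset.range (max (E.weight α) (E.weight β)), E.gst R α i * E.edg R β i)
        (if α = β then E.vtx R (E.range α) else 0)

/-- The ideal of the `R`-ring `R⟨X⟩` generated by the defining relations: the smallest two-sided
ideal that is an `R`-subbimodule and contains all differences of the two sides of a relation. -/
noncomputable def relIdeal : TwoSidedIdeal (FreeRRing R E.Gen) :=
  sInf {I | (∀ a b, E.Rel R a b → a - b ∈ I) ∧
    ∀ (r : R), ∀ a ∈ I, r • a ∈ I ∧ MulOpposite.op r • a ∈ I}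

/-- The weighted Leavitt path algebra `L_R(E, ω)`, a ring that need not have a unit. -/
abbrev LeavittPathAlgebra : Type (max u v w) := (E.relIdeal R).ringCon.Quotient

end WeightedGraph

/-- A (not necessarily unital) ring is a domain if it is non-zero and has no zero divisors. -/
def IsRingDomain (A : Type w) [NonUnitalRing A] : Prop :=
  Nontrivial A ∧ ∀ a b : A, a * b = 0 → a = 0 ∨ b = 0

/-- The generators of the Leavitt algebra `L_R(n, m)`: the entries of an `n × m` matrix `Y` and of
an `m × n` matrix `X`. -/
inductive LeavittGen (n m : ℕ) : Type
  | y (i : Fin n) (j : Fin m) : LeavittGen n m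
  | x (j : Fin m) (i : Fin n) : LeavittGen n m

namespace LeavittAlgebra

variable (R : Type w) [Ring R] (n m : ℕ)

/-- The free unital `R`-ring on the generators; the coefficients commute with the generators. -/
abbrev Free : Type w := MonoidAlgebra R (FreeMonoid (LeavittGen n m))

/-- The matrix `Y` of generators. -/
noncomputable def matY : Matrix (Fin n) (Fin m) (Free R n m) :=
  fun i j => MonoidAlgebra.single (FreeMonoid.of (.y i j)) 1

/-- The matrix `X` of generators. -/
noncomputable def matX : Matrix (Fin m) (Fin n) (Free R n m) :=
  fun j i => MonoidAlgebra.single (FreeMonoid.of (.x j i)) 1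

/-- The defining relations, entrywise: `Y * X = 1` and `X * Y = 1`. -/
inductive Rel : Free R n m → Free R n m → Prop
  | matY_mul_matX (i i' : Fin n) :
      Rel ((matY R n m * matX R n m) i i') ((1 : Matrix (Fin n) (Fin n) (Free R n m)) i i')
  | matX_mul_matY (j j' : Fin m) :
      Rel ((matX R n m * matY R n m) j j') ((1 : Matrix (Fin m) (Fin m) (Free R n m)) j j')

end LeavittAlgebra

/-- The Leavitt algebra `L_R(n, m)`: the unital ring generated over `R` by the entries of `Y` and
`X`, subject to `Y * X = 1` and `X * Y = 1`. -/
abbrev LeavittAlgebra (R : Type w) [Ring R] (n m : ℕ) : Type w :=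
  RingQuot (LeavittAlgebra.Rel R n m)

/-!
Let `Y` and `X` be the matrices of generators of a Leavitt algebra, or the matrices `(α_i)` and
`(α_i*)` of an LV-rose. Then the block matrix with off-diagonal blocks `Y` and `X` squares to `1`,
and it is supported on the edges of a bipartite graph. In the universal ring for such matrices
`Z`, choose for each vertex `p` a common neighbour `h = hub p` of the opposite side and use the
relation `Z p h * Z h r = δ_{pr} - ∑_{s ≠ h} Z p s * Z s r` to eliminate the left-hand side. The
remaining words form a basis, on which `Z` acts by reduction to normal form. Let `m_s` and `n_s`
be the coefficients of `m` and `n` at words `a (p, s)` and `(s, r) b` of top length, with `a`,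
`p`, `r`, `b` fixed. If the product of `m` and `n` vanishes, so do its top coefficients, whence
`m_s n_{s'} = δ_{ss'} m_h n_h` for all `s`, `s'`. The left-hand side has rank at most one, whereas
the right-hand side is a scalar matrix, whose size is at least two as soon as there are two
possible hubs. Over a domain of coefficients both vanish, and there are no zero divisors.

The algebra of an LV-rose embeds into such a ring, because its left regular representation factors
through it; for an unweighted rose with at most one petal the Laurent polynomials play the same
role.

For the converse, distinct vertices `v`, `w` satisfy `v w = 0`, a petal `α` of weight one and any
other petal `β` satisfy `α₁* β₁ = 0`, and if `α` is the only petal of maximal weight `k ≥ 2`, then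
`α_k α₁* = 0`. The generators are non-zero, even up to scalars of `R`, because `L_R(E, ω)` acts on
`E⁰ → R^ℕ`: the vertices act as projections and the edges as products of operators of Cuntz
families, one family for each relation.
-/

theorem commute_toAddMonoidEnd {R M : Type*} [Ring R] [AddCommGroup M] [Module R M] (r : R)
    (f : Module.End R M) :
    Commute (Module.toAddMonoidEnd R M r) (Module.toAddMonoidEnd (Module.End R M) M f) :=
  AddMonoidHom.ext fun m => (f.map_smul r m).symm

section PresentedRing

variable {R : Type*} [Ring R] {X A : Type*} [Ring A]

theorem commute_freeMonoid_lift {c : R →+* A} {f : X → A} (hcf : ∀ r x, Commute (c r) (f x))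
    (r : R) (m : FreeMonoid X) : Commute (c r) (FreeMonoid.lift f m) := by
  induction m using FreeMonoid.recOn with
  | one => simp
  | of_mul x m hm => simpa using (hcf r x).mul_right hm

/-- The ring homomorphism from the free unital `R`-ring on `X` given by a ring homomorphism on the
coefficients and commuting images of the generators. -/
noncomputable def freeRingLift (c : R →+* A) (f : X → A) (hcf : ∀ r x, Commute (c r) (f x)) :
    MonoidAlgebra R (FreeMonoid X) →+* A :=
  MonoidAlgebra.liftNCRingHom c (FreeMonoid.lift f) (commute_freeMonoid_lift hcf)

theorem freeRingLift_single_one (c : R →+* A) (f : X → A) (hcf : ∀ r x, Commute (c r) (f x))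
    (r : R) : freeRingLift c f hcf (MonoidAlgebra.single 1 r) = c r := by
  simp [freeRingLift]

variable (R) in
/-- The generators of the free unital `R`-ring on `X`. -/
noncomputable def freeRingGen (x : X) : MonoidAlgebra R (FreeMonoid X) :=
  MonoidAlgebra.single (FreeMonoid.of x) 1

theorem freeRingLift_freeRingGen (c : R →+* A) (f : X → A) (hcf : ∀ r x, Commute (c r) (f x))
    (x : X) : freeRingLift c f hcf (freeRingGen R x) = f x := by
  simp [freeRingLift, freeRingGen]

/-- The unital `R`-ring generated by `X` subject to the relations `s`, where the coefficients
commute with the generators. -/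
abbrev PresentedRing (R : Type*) [Ring R] {X : Type*}
    (s : MonoidAlgebra R (FreeMonoid X) → MonoidAlgebra R (FreeMonoid X) → Prop) : Type _ :=
  RingQuot s

namespace PresentedRing

variable (s : MonoidAlgebra R (FreeMonoid X) → MonoidAlgebra R (FreeMonoid X) → Prop)

/-- The coefficient homomorphism of a presented `R`-ring. -/
noncomputable def const : R →+* PresentedRing R s :=
  (RingQuot.mkRingHom s).comp MonoidAlgebra.singleOneRingHom

/-- The generators of a presented `R`-ring. -/
noncomputable def gen (x : X) : PresentedRing R s :=
  RingQuot.mkRingHom s (freeRingGen R x)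

theorem commute_const_gen (r : R) (x : X) : Commute (const s r) (gen s x) := by
  simp [Commute, SemiconjBy, const, gen, freeRingGen, ← map_mul, MonoidAlgebra.single_mul_single]

/-- The universal property of a presented `R`-ring. -/
noncomputable def lift (c : R →+* A) (f : X → A) (hcf : ∀ r x, Commute (c r) (f x))
    (hs : ∀ a b, s a b → freeRingLift c f hcf a = freeRingLift c f hcf b) :
    PresentedRing R s →+* A :=
  RingQuot.lift ⟨freeRingLift c f hcf, fun a b => hs a b⟩

theorem lift_const (c : R →+* A) (f : X → A) (hcf : ∀ r x, Commute (c r) (f x))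
    (hs : ∀ a b, s a b → freeRingLift c f hcf a = freeRingLift c f hcf b) (r : R) :
    lift s c f hcf hs (const s r) = c r := by
  simpa [lift, const] using freeRingLift_single_one c f hcf r

theorem lift_gen (c : R →+* A) (f : X → A) (hcf : ∀ r x, Commute (c r) (f x))
    (hs : ∀ a b, s a b → freeRingLift c f hcf a = freeRingLift c f hcf b) (x : X) :
    lift s c f hcf hs (gen s x) = f x := by
  simpa [lift, gen] using freeRingLift_freeRingGen c f hcf x

variable {s}

theorem ringHom_ext {φ ψ : PresentedRing R s →+* A} (hc : ∀ r, φ (const s r) = ψ (const s r))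
    (hg : ∀ x, φ (gen s x) = ψ (gen s x)) : φ = ψ := by
  apply RingQuot.ringQuot_ext
  exact MonoidAlgebra.ringHom_ext' (RingHom.ext hc) (FreeMonoid.hom_eq hg)

theorem induction_on {P : PresentedRing R s → Prop} (b : PresentedRing R s)
    (add : ∀ a b, P a → P b → P (a + b)) (one : P 1)
    (const_mul : ∀ r a, P a → P (const s r * a))
    (gen_mul : ∀ x a, P a → P (gen s x * a)) : P b := by
  obtain ⟨b, rfl⟩ := RingQuot.mkRingHom_surjective s b
  induction b using MonoidAlgebra.induction_linear with
  | zero => simpa using const_mul 0 1 one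
  | add a b ha hb => rw [map_add]; exact add _ _ ha hb
  | single m r =>
    have hm : P (RingQuot.mkRingHom s (MonoidAlgebra.single m 1)) := by
      induction m using FreeMonoid.recOn with
      | one => exact (map_one (RingQuot.mkRingHom s)).symm ▸ one
      | of_mul x m hm =>
        simpa [gen, freeRingGen, ← map_mul, MonoidAlgebra.single_mul_single] using gen_mul x _ hm
    simpa [const, ← map_mul, MonoidAlgebra.single_mul_single] using const_mul r _ hm

end PresentedRing

end PresentedRing

/-- A symmetric graph in which `hub p` is a chosen neighbour of the vertex `p`, depending only on
the connected component of `p` and on its side in a bipartition: two vertices with a common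
neighbour have the same hub. It records which entries of a matrix with square `1` may be non-zero,
and the hubs say which monomial of each entry of the equation `Y * Y = 1` is eliminated. -/
structure HubGraph (K : Type*) where
  Adj : K → K → Prop
  hub : K → K
  symm : ∀ {p q}, Adj p q → Adj q p
  adj_hub : ∀ p, Adj p (hub p)
  hub_eq_hub : ∀ {p q r}, Adj p q → Adj q r → hub p = hub r

namespace HubGraph

variable {K : Type*} (G : HubGraph K)

section LeavittMatrix

variable [Fintype K] [DecidableEq K]

/-- A matrix over a ring that is supported on the edges of the graph and squares to `1`. -/
structure IsLeavittMatrix {A : Type*} [Ring A] (Y : Matrix K K A) : Prop where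
  eq_zero : ∀ p q, ¬ G.Adj p q → Y p q = 0
  mul_self : Y * Y = 1

variable {G} in
theorem IsLeavittMatrix.map {A B : Type*} [Ring A] [Ring B] {Y : Matrix K K A}
    (hY : G.IsLeavittMatrix Y) (f : A →+* B) : G.IsLeavittMatrix (Y.map f) where
  eq_zero p q hpq := by simp [hY.eq_zero p q hpq]
  mul_self := by
    rw [← Matrix.map_mul, hY.mul_self, Matrix.map_one f (map_zero f) (map_one f)]

variable (R : Type*) [Ring R]

/-- The relations saying that the generators, arranged in a matrix, form a Leavitt matrix. -/
inductive LeavittRel : MonoidAlgebra R (FreeMonoid (K × K)) →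
    MonoidAlgebra R (FreeMonoid (K × K)) → Prop
  | eq_zero (p q : K) (h : ¬ G.Adj p q) : LeavittRel (freeRingGen R (p, q)) 0
  | mul_self (p q : K) :
      LeavittRel (∑ s, freeRingGen R (p, s) * freeRingGen R (s, q)) (if p = q then 1 else 0)

/-- The unital `R`-ring generated by the entries of a universal Leavitt matrix. -/
def LeavittRing : Type _ := PresentedRing R (G.LeavittRel R)

noncomputable instance : Ring (G.LeavittRing R) :=
  inferInstanceAs (Ring (PresentedRing R (G.LeavittRel R)))

namespace LeavittRing

/-- The coefficient homomorphism. -/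
noncomputable def const : R →+* G.LeavittRing R := PresentedRing.const _

/-- The entries of the universal Leavitt matrix. -/
noncomputable def arrow : Matrix K K (G.LeavittRing R) := fun p q => PresentedRing.gen _ (p, q)

theorem commute_const_arrow (r : R) (p q : K) : Commute (const G R r) (arrow G R p q) :=
  PresentedRing.commute_const_gen _ r (p, q)

theorem isLeavittMatrix_arrow : G.IsLeavittMatrix (arrow G R) where
  eq_zero p q hpq := (RingQuot.mkRingHom_rel (.eq_zero p q hpq)).trans (map_zero _)
  mul_self := by
    ext p q
    have relation := RingQuot.mkRingHom_rel (LeavittRel.mul_self (G := G) (R := R) p q)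
    rw [apply_ite (RingQuot.mkRingHom _), map_sum, map_one, map_zero] at relation
    simp only [map_mul] at relation
    rw [Matrix.mul_apply, Matrix.one_apply]
    exact relation

section Lift

variable {R} {A : Type*} [Ring A] (c : R →+* A) {Y : Matrix K K A} (hY : G.IsLeavittMatrix Y)
  (hcY : ∀ r p q, Commute (c r) (Y p q))

/-- The universal property of the universal Leavitt matrix. -/
noncomputable def lift : G.LeavittRing R →+* A :=
  PresentedRing.lift (G.LeavittRel R) c (fun x => Y x.1 x.2) (fun r x => hcY r x.1 x.2) <| by
    rintro _ _ (⟨p, q, hpq⟩ | ⟨p, q⟩)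
    · rw [map_zero, freeRingLift_freeRingGen, hY.eq_zero p q hpq]
    · simp only [apply_ite (freeRingLift _ _ _), map_sum, map_mul, freeRingLift_freeRingGen,
        map_one, map_zero]
      rw [← Matrix.mul_apply, hY.mul_self, Matrix.one_apply]

theorem lift_const (r : R) : lift G c hY hcY (const G R r) = c r :=
  PresentedRing.lift_const ..

theorem lift_arrow (p q : K) : lift G c hY hcY (arrow G R p q) = Y p q :=
  PresentedRing.lift_gen ..

end Lift

end LeavittRing

end LeavittMatrix

section Model

/-- The words `(p, q), (q, r)` with `q = hub p`: the monomials that `Y * Y = 1` eliminates. -/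
def Forbidden (x y : K × K) : Prop := x.2 = y.1 ∧ x.2 = G.hub x.1

/-- A word in the edges of the graph that contains no forbidden pair of consecutive letters. -/
def Normal (l : List (K × K)) : Prop :=
  (∀ x ∈ l, G.Adj x.1 x.2) ∧ l.IsChain fun x y => ¬ G.Forbidden x y

variable {G}

theorem normal_nil : G.Normal [] := by simp [Normal]

theorem normal_cons_iff {x : K × K} {l : List (K × K)} :
    G.Normal (x :: l) ↔
      G.Adj x.1 x.2 ∧ (∀ y ∈ l.head?, ¬ G.Forbidden x y) ∧ G.Normal l := by
  simp only [Normal, List.mem_cons, forall_eq_or_imp, List.isChain_cons]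
  tauto

theorem normal_append_iff {a b : List (K × K)} :
    G.Normal (a ++ b) ↔
      G.Normal a ∧ G.Normal b ∧ ∀ x ∈ a.getLast?, ∀ y ∈ b.head?, ¬ G.Forbidden x y := by
  simp only [Normal, List.mem_append, or_imp, forall_and, List.isChain_append]
  tauto

theorem Normal.cons_of_adj {p q r : K} {l : List (K × K)} (h : G.Normal ((p, r) :: l))
    (hqr : G.Adj q r) : G.Normal ((q, r) :: l) := by
  rw [normal_cons_iff] at h ⊢
  have hub_eq : G.hub q = G.hub p := G.hub_eq_hub hqr (G.symm h.1)
  simp only [Forbidden] at h ⊢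
  rw [hub_eq]
  exact ⟨hqr, h.2⟩

variable (G) (R : Type*) [Ring R]

/-- The free `R`-module on the normal words; `Y` acts on it by left multiplication followed by
reduction to normal form. -/
abbrev Model : Type _ := {l : List (K × K) // G.Normal l} →₀ R

open Classical in
/-- The basis vector of a normal word; it is `0` if the word is not normal. -/
noncomputable def nf (l : List (K × K)) : G.Model R :=
  if h : G.Normal l then Finsupp.single ⟨l, h⟩ 1 else 0

variable {G R}

theorem nf_of_normal {l : List (K × K)} (h : G.Normal l) : G.nf R l = Finsupp.single ⟨l, h⟩ 1 :=
  dif_pos h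

theorem nf_of_not_normal {l : List (K × K)} (h : ¬ G.Normal l) : G.nf R l = 0 := dif_neg h

theorem model_lhom_ext {M : Type*} [AddCommGroup M] [Module R M] {f g : G.Model R →ₗ[R] M}
    (h : ∀ l, G.Normal l → f (G.nf R l) = g (G.nf R l)) : f = g := by
  refine Finsupp.lhom_ext' fun ⟨l, hl⟩ => LinearMap.ext_ring ?_
  simpa [nf_of_normal hl] using h l hl

variable [Fintype K] [DecidableEq K]

variable (G R) in
/-- The normal form of the letter `(p, q)` followed by a normal word. -/
noncomputable def actWord (p q : K) : List (K × K) → G.Model R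
  | [] => G.nf R [(p, q)]
  | (q', r) :: l =>
    if q = q' ∧ q = G.hub p then
      (if p = r then G.nf R l else 0) - ∑ s ∈ {q}ᶜ, G.nf R ((p, s) :: (s, r) :: l)
    else G.nf R ((p, q) :: (q', r) :: l)

variable (G R) in
/-- The action of the entry `(p, q)` of `Y` on the model. -/
noncomputable def act : Matrix K K (Module.End R (G.Model R)) :=
  fun p q => Finsupp.linearCombination R fun l => G.actWord R p q l.1

theorem act_nf {l : List (K × K)} (hl : G.Normal l) (p q : K) :
    G.act R p q (G.nf R l) = G.actWord R p q l := by
  simp [act, nf_of_normal hl]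

theorem act_nf_of_not_forbidden {p q : K} {l : List (K × K)}
    (h : ∀ y ∈ l.head?, ¬ G.Forbidden (p, q) y) :
    G.act R p q (G.nf R l) = G.nf R ((p, q) :: l) := by
  by_cases hl : G.Normal l
  · rw [act_nf hl]
    rcases l with _ | ⟨⟨q', r⟩, l⟩
    · rfl
    · exact if_neg (h _ rfl)
  · rw [nf_of_not_normal hl, map_zero, nf_of_not_normal fun h' => hl (normal_cons_iff.1 h').2.2]

theorem act_nf_hub {p r : K} {l : List (K × K)} (hl : G.Normal ((G.hub p, r) :: l)) :
    G.act R p (G.hub p) (G.nf R ((G.hub p, r) :: l)) =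
      (if p = r then G.nf R l else 0) -
        ∑ s ∈ {G.hub p}ᶜ, G.nf R ((p, s) :: (s, r) :: l) := by
  rw [act_nf hl]
  exact if_pos ⟨rfl, rfl⟩

theorem act_eq_zero {p q : K} (h : ¬ G.Adj p q) : G.act R p q = 0 := by
  refine model_lhom_ext fun l _ => ?_
  have not_forbidden (y : K × K) : ¬ G.Forbidden (p, q) y := by
    rintro ⟨-, rfl : q = G.hub p⟩
    exact h (G.adj_hub p)
  rw [act_nf_of_not_forbidden fun y _ => not_forbidden y,
    nf_of_not_normal fun hl => h (normal_cons_iff.1 hl).1, LinearMap.zero_apply]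

theorem act_mul_act_nf_of_forall_normal {r : K} {l : List (K × K)}
    (hl : ∀ q, G.Adj q r → G.Normal ((q, r) :: l)) (p : K) :
    (G.act R * G.act R) p r (G.nf R l) =
      (1 : Matrix K K (Module.End R (G.Model R))) p r (G.nf R l) := by
  have act_nf_cons (q : K) : G.act R q r (G.nf R l) = G.nf R ((q, r) :: l) := by
    by_cases hq : G.Adj q r
    · exact act_nf_of_not_forbidden (normal_cons_iff.1 (hl q hq)).2.1
    · rw [act_eq_zero hq, nf_of_not_normal fun h => hq (normal_cons_iff.1 h).1,
        LinearMap.zero_apply]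
  have act_of_ne (q : K) (hq : q ∈ ({G.hub p}ᶜ : Finset K)) :
      G.act R p q (G.nf R ((q, r) :: l)) = G.nf R ((p, q) :: (q, r) :: l) :=
    act_nf_of_not_forbidden <| by simpa [Forbidden] using hq
  rw [Matrix.mul_apply, LinearMap.sum_apply, Matrix.one_apply,
    Fintype.sum_eq_add_sum_compl (G.hub p)]
  simp only [Module.End.mul_apply, act_nf_cons]
  rw [Finset.sum_congr rfl act_of_ne]
  by_cases hr : G.Adj (G.hub p) r
  · rw [act_nf_hub (hl _ hr), sub_add_cancel]
    split_ifs <;> rfl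
  · have not_normal (q : K) : ¬ G.Normal ((p, q) :: (q, r) :: l) := fun h => by
      have hpq := (normal_cons_iff.1 h).1
      have hqr := (normal_cons_iff.1 (normal_cons_iff.1 h).2.2).1
      exact hr (G.hub_eq_hub hpq hqr ▸ G.symm (G.adj_hub r))
    have hpr : p ≠ r := fun h => hr (h ▸ G.symm (G.adj_hub p))
    have not_normal_hub : ¬ G.Normal ((G.hub p, r) :: l) := fun h => hr (normal_cons_iff.1 h).1
    simp [nf_of_not_normal (not_normal _), nf_of_not_normal not_normal_hub, hpr]

/-- Associativity `Y * (Y * Y) = (Y * Y) * Y` yields the one instance of `Y * Y = 1` that is not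
visible on normal words. -/
theorem mul_self_apply_eq_of_forall_ne {M : Type*} [AddCommGroup M] [Module R M]
    (Y : Matrix K K (Module.End R M)) {m : M} {r h : K}
    (hr : ∀ q, (Y * Y) q r m = (1 : Matrix K K (Module.End R M)) q r m)
    (hs : ∀ s ≠ h, ∀ p, (Y * Y) p s (Y s r m) = (1 : Matrix K K (Module.End R M)) p s (Y s r m))
    (p : K) : (Y * Y) p h (Y h r m) = (1 : Matrix K K (Module.End R M)) p h (Y h r m) := by
  have apply_mul (A B : Matrix K K (Module.End R M)) (a b : K) (x : M) :
      (A * B) a b x = ∑ s, A a s (B s b x) := by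
    simp [Matrix.mul_apply, LinearMap.sum_apply]
  have sum_eq : ∑ s, (Y * Y) p s (Y s r m) =
      ∑ s, (1 : Matrix K K (Module.End R M)) p s (Y s r m) := by
    rw [← apply_mul, ← apply_mul, mul_assoc, one_mul, apply_mul]
    simp only [hr]
    rw [← apply_mul, mul_one]
  rw [Fintype.sum_eq_add_sum_compl h, Fintype.sum_eq_add_sum_compl h,
    Finset.sum_congr rfl fun s hs' => hs s (by simpa using hs') p] at sum_eq
  exact add_right_cancel sum_eq

variable (G R) in
theorem isLeavittMatrix_act : G.IsLeavittMatrix (G.act R) where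
  eq_zero _ _ := act_eq_zero
  mul_self := by
    refine Matrix.ext fun p p' => model_lhom_ext fun l hl => ?_
    by_cases hp' : ∃ r t, l = (p', r) :: t ∧ p' = G.hub r
    · obtain ⟨r, t, rfl, rfl⟩ := hp'
      have not_forbidden := (normal_cons_iff.1 hl).2.1
      rw [← act_nf_of_not_forbidden not_forbidden]
      refine mul_self_apply_eq_of_forall_ne (G.act R) (fun q => ?_) (fun s hs q => ?_) p
      · exact act_mul_act_nf_of_forall_normal (fun s hs => hl.cons_of_adj hs) q
      by_cases hsr : G.Adj s r
      · have hsl := hl.cons_of_adj hsr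
        rw [act_nf_of_not_forbidden (normal_cons_iff.1 hsl).2.1]
        refine act_mul_act_nf_of_forall_normal (fun q hq => normal_cons_iff.2 ⟨hq, ?_, hsl⟩) q
        rintro _ ⟨⟩ ⟨-, hub_eq⟩
        exact hs (hub_eq.trans (G.hub_eq_hub hq hsr))
      · simp [act_eq_zero hsr]
    · refine act_mul_act_nf_of_forall_normal (fun q hq => normal_cons_iff.2 ⟨hq, ?_, hl⟩) p
      rcases l with _ | ⟨⟨q', r⟩, t⟩
      · simp
      · rintro _ ⟨⟩ ⟨rfl, hub_eq⟩
        exact hp' ⟨r, t, rfl, hub_eq.trans (G.hub_eq_hub hq (normal_cons_iff.1 hl).1)⟩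

end Model

section Orbit

variable [Fintype K] [DecidableEq K] {R : Type*} [Ring R]

namespace LeavittRing

variable {G}

theorem induction_on {P : G.LeavittRing R → Prop} (b : G.LeavittRing R)
    (add : ∀ a b, P a → P b → P (a + b)) (one : P 1)
    (const_mul : ∀ r a, P a → P (const G R r * a))
    (arrow_mul : ∀ p q a, P a → P (arrow G R p q * a)) : P b :=
  PresentedRing.induction_on b add one const_mul fun x a => arrow_mul x.1 x.2 a

noncomputable instance : Module R (G.LeavittRing R) := Module.compHom _ (const G R)

instance : IsScalarTower R (G.LeavittRing R) (G.LeavittRing R) :=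
  ⟨fun r => mul_assoc (const G R r)⟩

theorem smul_one_eq_const (r : R) : r • (1 : G.LeavittRing R) = const G R r :=
  mul_one (const G R r)

section OfOperators

variable {M : Type*} [AddCommGroup M] [Module R M] {Y : Matrix K K (Module.End R M)}
  (hY : G.IsLeavittMatrix Y)

/-- The action on a module given by a Leavitt matrix of linear operators. -/
noncomputable def toEnd : G.LeavittRing R →+* AddMonoid.End M :=
  lift G (Module.toAddMonoidEnd R M) (hY.map (Module.toAddMonoidEnd (Module.End R M) M))
    fun r p q => commute_toAddMonoidEnd r (Y p q)

theorem toEnd_const_apply (r : R) (m : M) : toEnd hY (const G R r) m = r • m :=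
  DFunLike.congr_fun (lift_const ..) m

theorem toEnd_arrow_apply (p q : K) (m : M) : toEnd hY (arrow G R p q) m = Y p q m :=
  DFunLike.congr_fun (lift_arrow ..) m

end OfOperators

noncomputable instance : Module (G.LeavittRing R) (G.Model R) :=
  Module.compHom _ (toEnd (G.isLeavittMatrix_act R))

theorem arrow_smul_model (p q : K) (m : G.Model R) : arrow G R p q • m = G.act R p q m :=
  toEnd_arrow_apply ..

instance : IsScalarTower R (G.LeavittRing R) (G.Model R) where
  smul_assoc r b m := by
    change (const G R r * b) • m = _
    rw [mul_smul]
    exact toEnd_const_apply ..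

variable {N : Type*} [AddCommGroup N] [Module (G.LeavittRing R) N]

theorem sum_arrow_smul_arrow_smul (p r : K) (n : N) :
    ∑ s, arrow G R p s • arrow G R s r • n = if p = r then n else 0 := by
  simp only [← mul_smul]
  rw [← Finset.sum_smul, ← Matrix.mul_apply, (isLeavittMatrix_arrow G R).mul_self,
    Matrix.one_apply, ite_smul, one_smul, zero_smul]

variable (G R) in
/-- The product of the letters of a word. -/
noncomputable def word (l : List (K × K)) : G.LeavittRing R :=
  (l.map fun x => arrow G R x.1 x.2).prod

theorem word_nil : word G R [] = 1 := rfl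

theorem word_cons (x : K × K) (l : List (K × K)) :
    word G R (x :: l) = arrow G R x.1 x.2 * word G R l := List.prod_cons

variable [Module R N]

variable (R) in
/-- The `R`-linear map sending a normal word `l` to `word l • n`. -/
noncomputable def linearOrbit (n : N) : G.Model R →ₗ[R] N :=
  Finsupp.linearCombination R fun l => word G R l.1 • n

theorem linearOrbit_nf {l : List (K × K)} (hl : G.Normal l) (n : N) :
    linearOrbit R n (G.nf R l) = word G R l • n := by
  simp [linearOrbit, nf_of_normal hl]

theorem linearOrbit_nf_cons {p q : K} {l : List (K × K)}
    (h : G.Adj p q → ∀ y ∈ l.head?, ¬ G.Forbidden (p, q) y) (n : N) :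
    linearOrbit R n (G.nf R ((p, q) :: l)) = arrow G R p q • linearOrbit R n (G.nf R l) := by
  by_cases hpq : G.Adj p q
  · by_cases hl : G.Normal l
    · rw [linearOrbit_nf (normal_cons_iff.2 ⟨hpq, h hpq, hl⟩), linearOrbit_nf hl, word_cons,
        mul_smul]
    · rw [nf_of_not_normal hl, nf_of_not_normal fun h' => hl (normal_cons_iff.1 h').2.2, map_zero,
        smul_zero]
  · rw [nf_of_not_normal fun h' => hpq (normal_cons_iff.1 h').1,
      (isLeavittMatrix_arrow G R).eq_zero p q hpq, map_zero, zero_smul]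

theorem linearOrbit_act_nf_hub {p r : K} {l : List (K × K)} (hl : G.Normal ((G.hub p, r) :: l))
    (n : N) :
    linearOrbit R n (G.act R p (G.hub p) (G.nf R ((G.hub p, r) :: l))) =
      arrow G R p (G.hub p) • linearOrbit R n (G.nf R ((G.hub p, r) :: l)) := by
  have orbit_cons (s : K) : linearOrbit R n (G.nf R ((s, r) :: l)) =
      arrow G R s r • linearOrbit R n (G.nf R l) :=
    linearOrbit_nf_cons (fun hsr => (normal_cons_iff.1 (hl.cons_of_adj hsr)).2.1) n
  have orbit_cons_cons (s : K) (hs : s ∈ ({G.hub p}ᶜ : Finset K)) :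
      linearOrbit R n (G.nf R ((p, s) :: (s, r) :: l)) =
        arrow G R p s • arrow G R s r • linearOrbit R n (G.nf R l) := by
    rw [linearOrbit_nf_cons (by simpa [Forbidden] using fun _ => hs), orbit_cons]
  rw [act_nf_hub hl, map_sub, map_sum, Finset.sum_congr rfl orbit_cons_cons, sub_eq_iff_eq_add,
    orbit_cons, ← Fintype.sum_eq_add_sum_compl
      (f := fun s => arrow G R p s • arrow G R s r • linearOrbit R n (G.nf R l)),
    sum_arrow_smul_arrow_smul, apply_ite (linearOrbit R n), map_zero]

variable [IsScalarTower R (G.LeavittRing R) N]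

theorem const_smul (r : R) (n : N) : const G R r • n = r • n := by
  rw [← smul_one_eq_const, smul_assoc, one_smul]

theorem arrow_smul_smul (p q : K) (r : R) (n : N) :
    arrow G R p q • r • n = r • arrow G R p q • n := by
  rw [← const_smul (G := G) r n, ← const_smul (G := G) r (arrow G R p q • n), ← mul_smul,
    ← mul_smul, (commute_const_arrow G R r p q).eq]

theorem linearOrbit_act (p q : K) (n : N) (m : G.Model R) :
    linearOrbit R n (G.act R p q m) = arrow G R p q • linearOrbit R n m := by
  let smulArrow : N →ₗ[R] N :=
    { toFun := fun n => arrow G R p q • n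
      map_add' := smul_add _
      map_smul' := fun r n => arrow_smul_smul p q r n }
  suffices linearOrbit R n ∘ₗ G.act R p q = smulArrow ∘ₗ linearOrbit R n from congr($this m)
  refine model_lhom_ext fun l hl => ?_
  change linearOrbit R n (G.act R p q (G.nf R l)) = arrow G R p q • linearOrbit R n (G.nf R l)
  by_cases hub : ∀ y ∈ l.head?, ¬ G.Forbidden (p, q) y
  · rw [act_nf_of_not_forbidden hub, linearOrbit_nf_cons fun _ => hub]
  · push Not at hub
    obtain ⟨⟨_, r⟩, hy, rfl, rfl : q = G.hub p⟩ := hub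
    obtain ⟨t, rfl⟩ := List.head?_eq_some_iff.1 hy
    exact linearOrbit_act_nf_hub hl n

/-- The model is freely generated by the empty word: this is the linear map that sends the empty
word to `n`. -/
noncomputable def orbit (n : N) : G.Model R →ₗ[G.LeavittRing R] N where
  toFun := linearOrbit R n
  map_add' := map_add _
  map_smul' b m := by
    rw [RingHom.id_apply]
    induction b using induction_on with
    | add a b ha hb => rw [add_smul, map_add, ha, hb, add_smul]
    | one => rw [one_smul, one_smul]
    | const_mul r a ha => rw [mul_smul, mul_smul, const_smul, const_smul, map_smul, ha]
    | arrow_mul p q a ha => rw [mul_smul, mul_smul, arrow_smul_model, linearOrbit_act, ha]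

theorem orbit_nf {l : List (K × K)} (hl : G.Normal l) (n : N) :
    orbit n (G.nf R l) = word G R l • n := linearOrbit_nf hl n

theorem orbit_nf_nil (n : N) : orbit n (G.nf R []) = n := by
  rw [orbit_nf normal_nil, word_nil, one_smul]

theorem mul_smul_nf_nil (b c : G.LeavittRing R) :
    (b * c) • G.nf R [] = orbit (c • G.nf R []) (b • G.nf R []) := by
  rw [map_smul, orbit_nf_nil, mul_smul]

theorem smul_nf_nil_injective :
    Function.Injective fun b : G.LeavittRing R => b • G.nf R [] :=
  Function.LeftInverse.injective (g := orbit (1 : G.LeavittRing R)) fun b => by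
    rw [map_smul, orbit_nf_nil, smul_eq_mul, mul_one]

end LeavittRing

end Orbit

section TopCoefficient

variable {R : Type*} [Ring R]

open Classical in
/-- The coefficient of a word in a vector of the model; it is `0` if the word is not normal. -/
noncomputable def coeff (l : List (K × K)) : G.Model R →ₗ[R] R :=
  if h : G.Normal l then Finsupp.lapply ⟨l, h⟩ else 0

/-- The span of the normal words of length at most `k`. -/
def lengthLE (k : ℕ) : Submodule R (G.Model R) :=
  Finsupp.supported R R {l : {l : List (K × K) // G.Normal l} | l.1.length ≤ k}

variable {G}

theorem coeff_nf_of_normal_left [DecidableEq K] {l : List (K × K)} (hl : G.Normal l)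
    (l' : List (K × K)) :
    G.coeff l (G.nf R l') = if l = l' then 1 else 0 := by
  by_cases hl' : G.Normal l'
  · simp [coeff, hl, nf_of_normal hl', Finsupp.single_apply, eq_comm]
  · have hne : l ≠ l' := fun h => hl' (h ▸ hl)
    simp [nf_of_not_normal hl', hne]

theorem coeff_nf_of_normal_right [DecidableEq K] (l : List (K × K)) {l' : List (K × K)}
    (hl' : G.Normal l') :
    G.coeff l (G.nf R l') = if l = l' then 1 else 0 := by
  by_cases hl : G.Normal l
  · exact coeff_nf_of_normal_left hl l'
  · have hne : l ≠ l' := fun h => hl (h ▸ hl')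
    simp [coeff, hl, hne]

theorem normal_of_coeff_ne_zero {l : List (K × K)} {m : G.Model R} (h : G.coeff l m ≠ 0) :
    G.Normal l := by
  by_contra hl
  exact h (by simp [coeff, hl])

theorem nf_mem_lengthLE {l : List (K × K)} {k : ℕ} (h : l.length ≤ k) :
    G.nf R l ∈ G.lengthLE k := by
  by_cases hl : G.Normal l
  · rw [nf_of_normal hl]
    exact Finsupp.single_mem_supported R 1 h
  · rw [nf_of_not_normal hl]
    exact zero_mem _

theorem coeff_eq_zero_of_mem_lengthLE {k : ℕ} {m : G.Model R} (hm : m ∈ G.lengthLE k)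
    {l : List (K × K)} (hl : k < l.length) : G.coeff l m = 0 := by
  by_cases h : G.Normal l
  · have notMem : (⟨l, h⟩ : {l // G.Normal l}) ∉ m.support := fun hmem =>
      not_le.2 hl ((Finsupp.mem_supported R m).1 hm hmem)
    simpa [coeff, h] using notMem
  · simp [coeff, h]

theorem lengthLE_eq_span (k : ℕ) :
    (G.lengthLE k : Submodule R (G.Model R)) =
      Submodule.span R {m | ∃ l, G.Normal l ∧ l.length ≤ k ∧ G.nf R l = m} := by
  rw [lengthLE, Finsupp.supported_eq_span_single]
  congr 1
  ext m
  constructor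
  · rintro ⟨⟨l, hl⟩, hlk, rfl⟩
    exact ⟨l, hl, hlk, nf_of_normal hl⟩
  · rintro ⟨l, hl, hlk, rfl⟩
    exact ⟨⟨l, hl⟩, hlk, (nf_of_normal hl).symm⟩

theorem eqOn_lengthLE {M : Type*} [AddCommGroup M] [Module R M] {k : ℕ} {f g : G.Model R →ₗ[R] M}
    (h : ∀ l, G.Normal l → l.length ≤ k → f (G.nf R l) = g (G.nf R l)) :
    Set.EqOn f g (G.lengthLE k : Submodule R (G.Model R)) := by
  rw [lengthLE_eq_span]
  refine LinearMap.eqOn_span ?_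
  rintro _ ⟨l, hl, hlk, rfl⟩
  exact h l hl hlk

theorem exists_leading_word {m : G.Model R} (hm : m ≠ 0) :
    ∃ l, G.coeff l m ≠ 0 ∧ m ∈ G.lengthLE l.length := by
  obtain ⟨⟨l, hl⟩, hmem, hmax⟩ := m.support.exists_max_image (fun l => l.1.length)
    (Finsupp.support_nonempty_iff.2 hm)
  exact ⟨l, by simpa [coeff, hl] using hmem, (Finsupp.mem_supported R m).2 fun l' hl' =>
    hmax l' hl'⟩

theorem eq_smul_nf_nil_of_mem_lengthLE_zero {m : G.Model R} (hm : m ∈ G.lengthLE 0) :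
    m = G.coeff [] m • G.nf R [] := by
  classical
  refine eqOn_lengthLE (f := LinearMap.id)
    (g := LinearMap.toSpanSingleton R _ (G.nf R []) ∘ₗ G.coeff []) (fun l hl hlk => ?_) hm
  obtain rfl := List.length_eq_zero_iff.1 (Nat.le_zero.1 hlk)
  simp [coeff_nf_of_normal_left normal_nil]

variable [Fintype K] [DecidableEq K]

theorem act_mem_lengthLE {k : ℕ} {m : G.Model R} (hm : m ∈ G.lengthLE k) (p q : K) :
    G.act R p q m ∈ G.lengthLE (k + 1) := by
  suffices G.lengthLE k ≤ (G.lengthLE (k + 1)).comap (G.act R p q) from this hm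
  rw [lengthLE_eq_span, Submodule.span_le]
  rintro _ ⟨l, hl, hlk, rfl⟩
  rw [SetLike.mem_coe, Submodule.mem_comap, act_nf hl]
  rcases l with _ | ⟨⟨q', r⟩, l⟩
  · exact nf_mem_lengthLE (by simp)
  · rw [List.length_cons] at hlk
    dsimp only [actWord]
    split_ifs
    · refine sub_mem (nf_mem_lengthLE (by lia)) (sum_mem fun s _ => nf_mem_lengthLE ?_)
      simpa using hlk
    · refine sub_mem (zero_mem _) (sum_mem fun s _ => nf_mem_lengthLE ?_)
      simpa using hlk
    · exact nf_mem_lengthLE (by simpa using hlk)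

namespace LeavittRing

theorem word_append (a b : List (K × K)) : word G R (a ++ b) = word G R a * word G R b := by
  simp [word]

theorem word_smul_mem_lengthLE (a : List (K × K)) {k : ℕ} {m : G.Model R}
    (hm : m ∈ G.lengthLE k) : word G R a • m ∈ G.lengthLE (a.length + k) := by
  induction a with
  | nil => simpa [word_nil] using hm
  | cons x a ih =>
    rw [word_cons, mul_smul, arrow_smul_model, List.length_cons, add_right_comm]
    exact act_mem_lengthLE ih _ _

theorem word_smul_nf_of_normal {a b : List (K × K)} (h : G.Normal (a ++ b)) :
    word G R a • G.nf R b = G.nf R (a ++ b) := by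
  induction a with
  | nil => simp [word_nil]
  | cons x a ih =>
    rw [List.cons_append, normal_cons_iff] at h
    rw [word_cons, mul_smul, ih h.2.2, arrow_smul_model, act_nf_of_not_forbidden h.2.1,
      List.cons_append]

theorem word_smul_nf_junction {a b : List (K × K)} {p r : K}
    (ha : G.Normal (a ++ [(p, G.hub p)])) (hb : G.Normal ((G.hub p, r) :: b)) :
    word G R (a ++ [(p, G.hub p)]) • G.nf R ((G.hub p, r) :: b) =
      word G R a • (if p = r then G.nf R b else 0) -
        ∑ s ∈ {G.hub p}ᶜ, G.nf R (a ++ [(p, s)] ++ (s, r) :: b) := by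
  have word_smul_nf (s : K) : word G R a • G.nf R ((p, s) :: (s, r) :: b) =
      G.nf R (a ++ [(p, s)] ++ (s, r) :: b) := by
    rw [List.append_assoc, List.singleton_append]
    by_cases h : G.Normal ((p, s) :: (s, r) :: b)
    · refine word_smul_nf_of_normal (normal_append_iff.2 ⟨(normal_append_iff.1 ha).1, h, ?_⟩)
      simpa [Forbidden] using (normal_append_iff.1 ha).2.2
    · rw [nf_of_not_normal h, nf_of_not_normal fun h' => h (normal_append_iff.1 h').2.1, smul_zero]
  rw [word_append, mul_smul, word_cons, word_nil, mul_one, arrow_smul_model, act_nf_hub hb,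
    smul_sub, Finset.smul_sum]
  simp only [word_smul_nf]

theorem coeff_word_smul_nf_junction {a b z : List (K × K)} {p r : K}
    (ha : G.Normal (a ++ [(p, G.hub p)])) (hb : G.Normal ((G.hub p, r) :: b))
    (hz : a.length + b.length < z.length) :
    G.coeff z (word G R (a ++ [(p, G.hub p)]) • G.nf R ((G.hub p, r) :: b)) =
      -∑ s ∈ {G.hub p}ᶜ, G.coeff z (G.nf R (a ++ [(p, s)] ++ (s, r) :: b)) := by
  have low : word G R a • (if p = r then G.nf R b else 0) ∈ G.lengthLE (a.length + b.length) := by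
    refine word_smul_mem_lengthLE a ?_
    split_ifs
    exacts [nf_mem_lengthLE le_rfl, zero_mem _]
  rw [word_smul_nf_junction ha hb, map_sub, coeff_eq_zero_of_mem_lengthLE low hz, zero_sub,
    map_sum]

end LeavittRing

end TopCoefficient

section Domain

/-- The neighbours of any hub have a second common neighbour. -/
def HasTwoHubs : Prop := ∀ p, ∃ s ≠ G.hub p, ∀ r, G.Adj (G.hub p) r → G.Adj s r

variable {G}

theorem exists_junction_of_not_normal_append {u v : List (K × K)} (hu : G.Normal u)
    (hv : G.Normal v) (huv : ¬ G.Normal (u ++ v)) :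
    ∃ a b p r, u = a ++ [(p, G.hub p)] ∧ v = (G.hub p, r) :: b := by
  have junction := fun h => huv (normal_append_iff.2 ⟨hu, hv, h⟩)
  simp only [imp_false, not_forall, not_not] at junction
  obtain ⟨⟨p, _⟩, hx, ⟨_, r⟩, hy, rfl, rfl : _ = G.hub p⟩ := junction
  obtain ⟨a, rfl⟩ := List.getLast?_eq_some_iff.1 hx
  obtain ⟨b, rfl⟩ := List.head?_eq_some_iff.1 hy
  exact ⟨a, b, p, r, rfl, rfl⟩

theorem normal_junction_iff {a b : List (K × K)} {p q q' r : K} :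
    G.Normal (a ++ [(p, q)] ++ (q', r) :: b) ↔
      G.Normal (a ++ [(p, q)]) ∧ G.Normal ((q', r) :: b) ∧ ¬ (q = q' ∧ q = G.hub p) := by
  rw [normal_append_iff]
  simp [Forbidden]

theorem append_eq_append_iff_of_length_le {α : Type*} {a b a' b' : List α}
    (ha : a'.length ≤ a.length) (hb : b'.length ≤ b.length) :
    a ++ b = a' ++ b' ↔ a = a' ∧ b = b' := by
  refine ⟨fun h => List.append_inj h ?_, by rintro ⟨rfl, rfl⟩; rfl⟩
  have hlen := congrArg List.length h
  simp only [List.length_append] at hlen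
  lia

theorem append_singleton_eq_iff {α : Type*} {a a' : List α} {x x' : α} :
    a ++ [x] = a' ++ [x'] ↔ a = a' ∧ x = x' :=
  ⟨fun h => by simpa using List.append_inj' h rfl, by rintro ⟨rfl, rfl⟩; rfl⟩

theorem junction_eq_junction_iff {α : Type*} {a b a' b' : List (α × α)} {p q q' r p' r' s : α}
    (ha : a'.length ≤ a.length) (hb : b'.length ≤ b.length) :
    a ++ [(p, q)] ++ (q', r) :: b = a' ++ [(p', s)] ++ (s, r') :: b' ↔
      s = q ∧ q = q' ∧ a = a' ∧ p = p' ∧ r = r' ∧ b = b' := by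
  rw [append_eq_append_iff_of_length_le (by simpa using ha) (by simpa using hb)]
  simp only [append_singleton_eq_iff, List.cons.injEq, Prod.mk.injEq]
  grind

variable [Fintype K] [DecidableEq K] {R : Type*} [Ring R]

namespace LeavittRing

/-- The two contributions to a monomial of top degree in a product of two words: concatenation, and
the elimination of a forbidden pair of letters at the junction. -/
theorem coeff_word_smul_nf {a b u v : List (K × K)} {p q q' r : K}
    (hz : G.Normal (a ++ [(p, q)] ++ (q', r) :: b)) (hu : G.Normal u) (hv : G.Normal v)
    (hua : u.length ≤ a.length + 1) (hvb : v.length ≤ b.length + 1) :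
    G.coeff (a ++ [(p, q)] ++ (q', r) :: b) (word G R u • G.nf R v) =
      G.coeff (a ++ [(p, q)]) (G.nf R u) * G.coeff ((q', r) :: b) (G.nf R v) -
        if q = q' then
          G.coeff (a ++ [(p, G.hub p)]) (G.nf R u) * G.coeff ((G.hub p, r) :: b) (G.nf R v)
        else 0 := by
  classical
  simp only [coeff_nf_of_normal_right _ hu, coeff_nf_of_normal_right _ hv, ite_zero_mul_ite_zero,
    mul_one]
  by_cases huv : G.Normal (u ++ v)
  · have hub_ne : ¬ (a ++ [(p, G.hub p)] = u ∧ (G.hub p, r) :: b = v) := by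
      rintro ⟨rfl, rfl⟩
      exact (normal_junction_iff.1 huv).2.2 ⟨rfl, rfl⟩
    rw [word_smul_nf_of_normal huv, coeff_nf_of_normal_left hz, if_neg hub_ne, ite_self, sub_zero]
    exact if_congr (append_eq_append_iff_of_length_le (by simpa using hua) (by simpa using hvb))
      rfl rfl
  · obtain ⟨a', b', p', r', rfl, rfl⟩ := exists_junction_of_not_normal_append hu hv huv
    have hua : a'.length ≤ a.length := by simpa using hua
    have hvb : b'.length ≤ b.length := by simpa using hvb
    have concat_ne : ¬ (a ++ [(p, q)] = a' ++ [(p', G.hub p')] ∧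
        (q', r) :: b = (G.hub p', r') :: b') := by
      rintro ⟨hl, hr⟩
      exact huv (hl ▸ hr ▸ hz)
    have hub_eq_iff : a ++ [(p, G.hub p)] = a' ++ [(p', G.hub p')] ∧
        (G.hub p, r) :: b = (G.hub p', r') :: b' ↔ a = a' ∧ p = p' ∧ r = r' ∧ b = b' := by
      simp only [append_singleton_eq_iff, List.cons.injEq, Prod.mk.injEq]
      grind
    rw [coeff_word_smul_nf_junction hu hv (by simp; lia), if_neg concat_ne, zero_sub]
    simp only [coeff_nf_of_normal_left hz, junction_eq_junction_iff hua hvb, hub_eq_iff]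
    by_cases h : q = q' ∧ a = a' ∧ p = p' ∧ r = r' ∧ b = b'
    · obtain ⟨rfl, rfl, rfl, rfl, rfl⟩ := h
      have q_ne : q ≠ G.hub p := fun hq => (normal_junction_iff.1 hz).2.2 ⟨rfl, hq⟩
      simp [q_ne]
    · simp [h, ← ite_and]

theorem word_smul_smul {N : Type*} [AddCommGroup N] [Module R N] [Module (G.LeavittRing R) N]
    [IsScalarTower R (G.LeavittRing R) N] (l : List (K × K)) (r : R) (n : N) :
    word G R l • r • n = r • word G R l • n := by
  induction l with
  | nil => simp [word_nil]
  | cons x l ih => rw [word_cons, mul_smul, ih, arrow_smul_smul, mul_smul]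

theorem coeff_word_smul {a b u : List (K × K)} {p q q' r : K}
    (hz : G.Normal (a ++ [(p, q)] ++ (q', r) :: b)) (hu : G.Normal u)
    (hua : u.length ≤ a.length + 1) {n : G.Model R} (hn : n ∈ G.lengthLE (b.length + 1)) :
    G.coeff (a ++ [(p, q)] ++ (q', r) :: b) (word G R u • n) =
      G.coeff (a ++ [(p, q)]) (G.nf R u) * G.coeff ((q', r) :: b) n -
        if q = q' then
          G.coeff (a ++ [(p, G.hub p)]) (G.nf R u) * G.coeff ((G.hub p, r) :: b) n
        else 0 := by
  let smulWord : G.Model R →ₗ[R] G.Model R :=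
    { toFun := fun n => word G R u • n
      map_add' := smul_add _
      map_smul' := word_smul_smul u }
  let coeffs : G.Model R →ₗ[R] R :=
    (if a ++ [(p, q)] = u then G.coeff ((q', r) :: b) else 0) -
      if q = q' then if a ++ [(p, G.hub p)] = u then G.coeff ((G.hub p, r) :: b) else 0 else 0
  have coeffs_apply (n : G.Model R) : coeffs n =
      G.coeff (a ++ [(p, q)]) (G.nf R u) * G.coeff ((q', r) :: b) n -
        if q = q' then
          G.coeff (a ++ [(p, G.hub p)]) (G.nf R u) * G.coeff ((G.hub p, r) :: b) n
        else 0 := by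
    simp only [coeffs, coeff_nf_of_normal_right _ hu, LinearMap.sub_apply]
    split_ifs <;> simp
  rw [← coeffs_apply]
  refine eqOn_lengthLE (f := G.coeff _ ∘ₗ smulWord) (fun v hv hvb => ?_) hn
  exact (coeff_word_smul_nf hz hu hv hua hvb).trans (coeffs_apply _).symm

theorem coeff_orbit {a b : List (K × K)} {p q q' r : K}
    (hz : G.Normal (a ++ [(p, q)] ++ (q', r) :: b)) {m n : G.Model R}
    (hm : m ∈ G.lengthLE (a.length + 1)) (hn : n ∈ G.lengthLE (b.length + 1)) :
    G.coeff (a ++ [(p, q)] ++ (q', r) :: b) (orbit n m) =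
      G.coeff (a ++ [(p, q)]) m * G.coeff ((q', r) :: b) n -
        if q = q' then
          G.coeff (a ++ [(p, G.hub p)]) m * G.coeff ((G.hub p, r) :: b) n
        else 0 := by
  let coeffs : G.Model R →ₗ[R] R :=
    (G.coeff (a ++ [(p, q)])).smulRight (G.coeff ((q', r) :: b) n) -
      if q = q' then (G.coeff (a ++ [(p, G.hub p)])).smulRight (G.coeff ((G.hub p, r) :: b) n)
      else 0
  have coeffs_apply (m : G.Model R) : coeffs m =
      G.coeff (a ++ [(p, q)]) m * G.coeff ((q', r) :: b) n -
        if q = q' then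
          G.coeff (a ++ [(p, G.hub p)]) m * G.coeff ((G.hub p, r) :: b) n
        else 0 := by
    simp only [coeffs, LinearMap.sub_apply]
    split_ifs <;> simp
  rw [← coeffs_apply]
  refine eqOn_lengthLE (f := G.coeff _ ∘ₗ (orbit n).restrictScalars R) (fun u hu hua => ?_) hm
  rw [coeffs_apply, ← coeff_word_smul hz hu hua hn, ← orbit_nf hu]
  rfl

theorem coeff_orbit_smul_nf_nil (d : R) (m : G.Model R) (l : List (K × K)) :
    G.coeff l (orbit (d • G.nf R []) m) = G.coeff l m * d := by
  suffices G.coeff l ∘ₗ (orbit (d • G.nf R [])).restrictScalars R = (G.coeff l).smulRight d from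
    congr($this m)
  refine model_lhom_ext fun u hu => ?_
  have orbit_eq : orbit (d • G.nf R []) (G.nf R u) = d • G.nf R u := by
    rw [orbit_nf hu, word_smul_smul, word_smul_nf_of_normal (by rwa [List.append_nil]),
      List.append_nil]
  simp only [LinearMap.comp_apply, LinearMap.coe_restrictScalars, orbit_eq, map_smul,
    LinearMap.smulRight_apply, smul_eq_mul, coeff_nf_of_normal_right l hu]
  split_ifs <;> simp

variable [NoZeroDivisors R]

theorem orbit_ne_zero_of_leading (h2 : G.HasTwoHubs) {a b : List (K × K)} {p q q' r : K}
    {m n : G.Model R} (hm : m ∈ G.lengthLE (a.length + 1)) (hn : n ∈ G.lengthLE (b.length + 1))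
    (hma : G.coeff (a ++ [(p, q)]) m ≠ 0) (hnb : G.coeff ((q', r) :: b) n ≠ 0) :
    orbit n m ≠ 0 := by
  intro orbit_eq
  have mul_eq {s s' : K} (hs : G.Normal (a ++ [(p, s)] ++ (s', r) :: b)) :
      G.coeff (a ++ [(p, s)]) m * G.coeff ((s', r) :: b) n =
        if s = s' then
          G.coeff (a ++ [(p, G.hub p)]) m * G.coeff ((G.hub p, r) :: b) n
        else 0 := by
    rw [← sub_eq_zero, ← coeff_orbit hs hm hn, orbit_eq, map_zero]
  have eq_of_ne_zero {s s' : K} (hs : G.coeff (a ++ [(p, s)]) m ≠ 0)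
      (hs' : G.coeff ((s', r) :: b) n ≠ 0) : s = s' := by
    by_contra hne
    have normal := normal_junction_iff.2
      ⟨normal_of_coeff_ne_zero hs, normal_of_coeff_ne_zero hs', fun h => hne h.1⟩
    exact mul_ne_zero hs hs' ((mul_eq normal).trans (if_neg hne))
  have mul_eq_hub {s : K} (ha : G.Normal (a ++ [(p, s)])) (hb : G.Normal ((s, r) :: b))
      (hs : s ≠ G.hub p) : G.coeff (a ++ [(p, s)]) m * G.coeff ((s, r) :: b) n =
        G.coeff (a ++ [(p, G.hub p)]) m * G.coeff ((G.hub p, r) :: b) n :=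
    (mul_eq (normal_junction_iff.2 ⟨ha, hb, fun h => hs h.2⟩)).trans (if_pos rfl)
  obtain rfl := eq_of_ne_zero hma hnb
  have hub_ne_zero :
      G.coeff (a ++ [(p, G.hub p)]) m * G.coeff ((G.hub p, r) :: b) n ≠ 0 := by
    by_cases hq : q = G.hub p
    · exact hq ▸ mul_ne_zero hma hnb
    · rw [← mul_eq_hub (normal_of_coeff_ne_zero hma) (normal_of_coeff_ne_zero hnb) hq]
      exact mul_ne_zero hma hnb
  have hma := left_ne_zero_of_mul hub_ne_zero
  have hnb := right_ne_zero_of_mul hub_ne_zero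
  obtain ⟨s, hs, adj_s⟩ := h2 p
  have ha : G.Normal (a ++ [(p, s)]) := by
    have ha := normal_of_coeff_ne_zero hma
    rw [normal_append_iff] at ha ⊢
    refine ⟨ha.1, normal_cons_iff.2 ⟨G.symm (adj_s p (G.symm (G.adj_hub p))), ?_, normal_nil⟩, ?_⟩
    · simp
    · simpa [Forbidden] using ha.2.2
  have hb : G.Normal ((s, r) :: b) := by
    have hb := normal_of_coeff_ne_zero hnb
    exact hb.cons_of_adj (adj_s r (normal_cons_iff.1 hb).1)
  rw [← mul_eq_hub ha hb hs] at hub_ne_zero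
  exact hs (eq_of_ne_zero hma (right_ne_zero_of_mul hub_ne_zero)).symm

theorem orbit_ne_zero (h2 : G.HasTwoHubs) {m n : G.Model R} (hm : m ≠ 0) (hn : n ≠ 0) :
    orbit n m ≠ 0 := by
  obtain ⟨l, hml, hm⟩ := exists_leading_word hm
  obtain ⟨l', hnl', hn⟩ := exists_leading_word hn
  rcases l.eq_nil_or_concat' with rfl | ⟨a, ⟨p, q⟩, rfl⟩
  · rw [eq_smul_nf_nil_of_mem_lengthLE_zero hm, LinearMap.map_smul_of_tower, orbit_nf_nil]
    intro smul_eq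
    have coeff_eq := congrArg (G.coeff l') smul_eq
    rw [map_smul, map_zero, smul_eq_mul] at coeff_eq
    exact mul_ne_zero hml hnl' coeff_eq
  rcases l' with _ | ⟨⟨q', r⟩, b⟩
  · rw [eq_smul_nf_nil_of_mem_lengthLE_zero hn]
    intro orbit_eq
    have coeff_eq := coeff_orbit_smul_nf_nil (G.coeff [] n) m (a ++ [(p, q)])
    rw [orbit_eq, map_zero] at coeff_eq
    exact mul_ne_zero hml hnl' coeff_eq.symm
  · exact orbit_ne_zero_of_leading h2 (by simpa using hm) hn hml hnl'

theorem isDomain [Nontrivial R] (h2 : G.HasTwoHubs) : IsDomain (G.LeavittRing R) := by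
  have smul_nf_nil_ne_zero {b : G.LeavittRing R} (hb : b ≠ 0) : b • G.nf R [] ≠ 0 := fun h =>
    hb (smul_nf_nil_injective (h.trans (zero_smul _ _).symm))
  have nf_nil_ne_zero : G.nf R [] ≠ 0 := by
    rw [nf_of_normal normal_nil]
    exact Finsupp.single_ne_zero.2 one_ne_zero
  have : Nontrivial (G.LeavittRing R) := nontrivial_of_ne 1 0 fun h =>
    nf_nil_ne_zero (by rw [← one_smul (G.LeavittRing R) (G.nf R []), h, zero_smul])
  have : NoZeroDivisors (G.LeavittRing R) := ⟨fun {b c} hbc => by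
    by_contra! h
    refine orbit_ne_zero h2 (smul_nf_nil_ne_zero h.1) (smul_nf_nil_ne_zero h.2) ?_
    rw [← mul_smul_nf_nil, hbc, zero_smul]⟩
  exact NoZeroDivisors.to_isDomain _

end LeavittRing

end Domain

section OfRel

variable {I P : Type*} (r : I → P → Prop) (i₀ : I) (α₀ : P) (hα : ∀ α, r i₀ α) (hi : ∀ i, r i α₀)

/-- The bipartite graph of a relation, with an element `i₀` of the left side and an element `α₀` of
the right side that are related to everything on the opposite side. -/
def ofRel : HubGraph (I ⊕ P) where
  Adj
    | .inl i, .inr α => r i α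
    | .inr α, .inl i => r i α
    | _, _ => False
  hub := Sum.elim (fun _ => .inr α₀) fun _ => .inl i₀
  symm := by rintro (i | α) (j | β) h <;> exact h
  adj_hub := by rintro (i | α) <;> simp_all
  hub_eq_hub := by rintro (i | α) (j | β) (k | γ) <;> simp

theorem hasTwoHubs_ofRel {i₁ : I} {α₁ : P} (hi₁ : i₁ ≠ i₀) (hα₁ : α₁ ≠ α₀) (hiα₁ : ∀ α, r i₁ α)
    (hα₁i : ∀ i, r i α₁) : (ofRel r i₀ α₀ hα hi).HasTwoHubs := by
  rintro (i | α)
  · refine ⟨.inr α₁, by simpa [ofRel] using hα₁, ?_⟩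
    rintro (j | β) h
    exacts [hα₁i j, h]
  · refine ⟨.inl i₁, by simpa [ofRel] using hi₁, ?_⟩
    rintro (j | β) h
    exacts [h, hiα₁ β]

variable [Fintype I] [Fintype P] [DecidableEq I] [DecidableEq P]

theorem isLeavittMatrix_ofRel_fromBlocks {A : Type*} [Ring A] {Y : Matrix I P A} {X : Matrix P I A}
    (hY : ∀ i α, ¬ r i α → Y i α = 0) (hX : ∀ i α, ¬ r i α → X α i = 0) (hYX : Y * X = 1)
    (hXY : X * Y = 1) :
    (ofRel r i₀ α₀ hα hi).IsLeavittMatrix (Matrix.fromBlocks 0 Y X 0) where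
  eq_zero := by
    rintro (i | α) (j | β) h
    exacts [rfl, hY i β h, hX j α h, rfl]
  mul_self := by simp [Matrix.fromBlocks_multiply, hYX, hXY]

variable {r i₀ α₀ hα hi}

theorem IsLeavittMatrix.eq_fromBlocks {A : Type*} [Ring A] {Z : Matrix (I ⊕ P) (I ⊕ P) A}
    (hZ : (ofRel r i₀ α₀ hα hi).IsLeavittMatrix Z) :
    Z = Matrix.fromBlocks 0 Z.toBlocks₁₂ Z.toBlocks₂₁ 0 := by
  ext (i | α) (j | β)
  exacts [hZ.eq_zero _ _ id, rfl, rfl, hZ.eq_zero _ _ id]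

theorem IsLeavittMatrix.blocks_mul {A : Type*} [Ring A] {Z : Matrix (I ⊕ P) (I ⊕ P) A}
    (hZ : (ofRel r i₀ α₀ hα hi).IsLeavittMatrix Z) :
    Z.toBlocks₁₂ * Z.toBlocks₂₁ = 1 ∧ Z.toBlocks₂₁ * Z.toBlocks₁₂ = 1 := by
  have mul_self := hZ.mul_self
  rw [hZ.eq_fromBlocks, Matrix.fromBlocks_multiply, ← Matrix.fromBlocks_one,
    Matrix.fromBlocks_inj] at mul_self
  simpa only [Matrix.zero_mul, zero_add, add_zero] using
    And.intro mul_self.1 mul_self.2.2.2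

end OfRel

end HubGraph

namespace LeavittAlgebra

open HubGraph

variable (R : Type*) [Ring R] (n m : ℕ)

/-- The matrix `Y` over the Leavitt algebra. -/
noncomputable def genY : Matrix (Fin n) (Fin m) (LeavittAlgebra R n m) :=
  fun i j => PresentedRing.gen (Rel R n m) (.y i j)

/-- The matrix `X` over the Leavitt algebra. -/
noncomputable def genX : Matrix (Fin m) (Fin n) (LeavittAlgebra R n m) :=
  fun j i => PresentedRing.gen (Rel R n m) (.x j i)

theorem genY_mul_genX : genY R n m * genX R n m = 1 := by
  ext i i'
  have relation := RingQuot.mkRingHom_rel (Rel.matY_mul_matX (R := R) (m := m) i i')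
  rw [Matrix.mul_apply, map_sum, Matrix.one_apply, apply_ite (RingQuot.mkRingHom _), map_one,
    map_zero] at relation
  simp only [map_mul] at relation
  rw [Matrix.mul_apply, Matrix.one_apply]
  exact relation

theorem genX_mul_genY : genX R n m * genY R n m = 1 := by
  ext j j'
  have relation := RingQuot.mkRingHom_rel (Rel.matX_mul_matY (R := R) (n := n) j j')
  rw [Matrix.mul_apply, map_sum, Matrix.one_apply, apply_ite (RingQuot.mkRingHom _), map_one,
    map_zero] at relation
  simp only [map_mul] at relation
  rw [Matrix.mul_apply, Matrix.one_apply]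
  exact relation

section Lift

variable {R n m} {A : Type*} [Ring A]

/-- The map on generators given by a pair of matrices. -/
def genValue (Y : Matrix (Fin n) (Fin m) A) (X : Matrix (Fin m) (Fin n) A) : LeavittGen n m → A
  | .y i j => Y i j
  | .x j i => X j i

theorem freeRingLift_eq_of_rel {Y : Matrix (Fin n) (Fin m) A} {X : Matrix (Fin m) (Fin n) A}
    (hYX : Y * X = 1) (hXY : X * Y = 1) (c : R →+* A)
    (hc : ∀ r x, Commute (c r) (genValue Y X x)) (a b : Free R n m) (hab : Rel R n m a b) :
    freeRingLift c (genValue Y X) hc a = freeRingLift c (genValue Y X) hc b := by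
  have map_matY (i : Fin n) (j : Fin m) :
      freeRingLift c (genValue Y X) hc (matY R n m i j) = Y i j := freeRingLift_freeRingGen ..
  have map_matX (j : Fin m) (i : Fin n) :
      freeRingLift c (genValue Y X) hc (matX R n m j i) = X j i := freeRingLift_freeRingGen ..
  rcases hab with ⟨i, i'⟩ | ⟨j, j'⟩
  · rw [Matrix.mul_apply, map_sum, Matrix.one_apply, apply_ite (freeRingLift _ _ _), map_one,
      map_zero, ← Matrix.one_apply, ← hYX, Matrix.mul_apply]
    simp only [map_mul, map_matY, map_matX]
  · rw [Matrix.mul_apply, map_sum, Matrix.one_apply, apply_ite (freeRingLift _ _ _), map_one,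
      map_zero, ← Matrix.one_apply, ← hXY, Matrix.mul_apply]
    simp only [map_mul, map_matY, map_matX]

/-- The universal property of the Leavitt algebra. -/
noncomputable def lift {Y : Matrix (Fin n) (Fin m) A} {X : Matrix (Fin m) (Fin n) A}
    (hYX : Y * X = 1) (hXY : X * Y = 1) (c : R →+* A)
    (hc : ∀ r x, Commute (c r) (genValue Y X x)) : LeavittAlgebra R n m →+* A :=
  PresentedRing.lift (Rel R n m) c (genValue Y X) hc (freeRingLift_eq_of_rel hYX hXY c hc)

end Lift

theorem isDomain [IsDomain R] (hn : 2 ≤ n) (hm : 2 ≤ m) : IsDomain (LeavittAlgebra R n m) := by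
  obtain ⟨i₁, i₀, hi⟩ := (Fin.nontrivial_iff_two_le.2 hn).exists_pair_ne
  obtain ⟨j₁, j₀, hj⟩ := (Fin.nontrivial_iff_two_le.2 hm).exists_pair_ne
  let G : HubGraph (Fin n ⊕ Fin m) :=
    .ofRel (fun _ _ => True) i₀ j₀ (fun _ => trivial) fun _ => trivial
  have isDomain_leavittRing : IsDomain (G.LeavittRing R) :=
    LeavittRing.isDomain (hasTwoHubs_ofRel _ _ _ _ _ hi hj (fun _ => trivial) fun _ => trivial)
  have blocks := (LeavittRing.isLeavittMatrix_arrow G R).blocks_mul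
  let φ : LeavittAlgebra R n m →+* G.LeavittRing R :=
    lift blocks.1 blocks.2 (LeavittRing.const G R) <| by
      rintro r (_ | _) <;> exact LeavittRing.commute_const_arrow ..
  let ψ : G.LeavittRing R →+* LeavittAlgebra R n m :=
    LeavittRing.lift G (PresentedRing.const _)
      (isLeavittMatrix_ofRel_fromBlocks _ _ _ _ _ (by simp) (by simp) (genY_mul_genX R n m)
        (genX_mul_genY R n m)) <| by
      rintro r (_ | _) (_ | _)
      exacts [.zero_right _, PresentedRing.commute_const_gen ..,
        PresentedRing.commute_const_gen .., .zero_right _]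
  have ψ_φ : ψ.comp φ = RingHom.id _ := by
    refine PresentedRing.ringHom_ext (fun r => ?_) fun x => ?_
    · exact (congrArg ψ (PresentedRing.lift_const (Rel R n m) ..)).trans
        (LeavittRing.lift_const ..)
    · refine (congrArg ψ (PresentedRing.lift_gen (Rel R n m) ..)).trans ?_
      rcases x with _ | _ <;> exact LeavittRing.lift_arrow ..
  exact Function.Injective.isDomain φ
    (Function.LeftInverse.injective (g := ψ) (DFunLike.congr_fun ψ_φ))

end LeavittAlgebra

section FreeRRing

variable {R : Type*} [Ring R] {X B : Type*} [Ring B]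

theorem commute_freeSemigroup_lift {c : R →+* B} {f : X → B} (hcf : ∀ r x, Commute (c r) (f x))
    (r : R) (m : FreeSemigroup X) : Commute (c r) (FreeSemigroup.lift f m) := by
  induction m using FreeSemigroup.recOnMul with
  | ih1 x => simpa using hcf r x
  | ih2 x y hx hy => rw [map_mul]; exact hx.mul_right hy

/-- The ring homomorphism from the free non-unital `R`-ring on `X` given by a ring homomorphism on
the coefficients and commuting images of the generators. -/
noncomputable def freeRRingLift (c : R →+* B) (f : X → B) (hcf : ∀ r x, Commute (c r) (f x)) :
    FreeRRing R X →ₙ+* B :=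
  { MonoidAlgebra.liftNC (c : R →+ B) (FreeSemigroup.lift f) with
    map_mul' := fun a b => MonoidAlgebra.liftNC_mul c (FreeSemigroup.lift f) a b
      fun {_ _} _ => commute_freeSemigroup_lift hcf _ _ }

variable {c : R →+* B} {f : X → B} (hcf : ∀ r x, Commute (c r) (f x))

theorem freeRRingLift_single (m : FreeSemigroup X) (r : R) :
    freeRRingLift c f hcf (MonoidAlgebra.single m r) = c r * FreeSemigroup.lift f m :=
  MonoidAlgebra.liftNC_single _ _ _ _

theorem freeRRingLift_smul (r : R) (a : FreeRRing R X) :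
    freeRRingLift c f hcf (r • a) = c r * freeRRingLift c f hcf a := by
  induction a using MonoidAlgebra.induction_linear with
  | zero => simp
  | add a b ha hb => rw [smul_add, map_add, ha, hb, map_add, mul_add]
  | single m s => simp only [MonoidAlgebra.smul_single, freeRRingLift_single, smul_eq_mul, map_mul,
      mul_assoc]

theorem freeRRingLift_op_smul (r : R) (a : FreeRRing R X) :
    freeRRingLift c f hcf (MulOpposite.op r • a) = freeRRingLift c f hcf a * c r := by
  induction a using MonoidAlgebra.induction_linear with
  | zero => simp
  | add a b ha hb => rw [smul_add, map_add, ha, hb, map_add, add_mul]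
  | single m s => simp only [MonoidAlgebra.smul_single, freeRRingLift_single, op_smul_eq_mul,
      map_mul, mul_assoc, (commute_freeSemigroup_lift hcf r m).eq]

end FreeRRing

namespace WeightedGraph

variable {E : WeightedGraph.{u, v}}

theorem mem_outEdges {v : E.Vertex} {α : E.StEdge} : α ∈ E.outEdges v ↔ E.source α = v := by
  simp [outEdges]

theorem weight_le_maxWeight (α : E.StEdge) : E.weight α ≤ E.maxWeight (E.source α) :=
  Finset.le_sup (f := E.weight) (mem_outEdges.2 rfl)

section IsLeavittFamily

variable {B C : Type*} [NonUnitalRing B] [NonUnitalRing C]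

/-- The value at the edge `α_{i+1}` of a family indexed by the generators, read as `0` if
`i + 1 > ω(α)`. -/
def edgeValue (f : E.Gen → B) (α : E.StEdge) (i : ℕ) : B :=
  if h : i < E.weight α then f (.edge α ⟨i, h⟩) else 0

/-- The value at the ghost edge `α_{i+1}*` of a family indexed by the generators, read as `0` if
`i + 1 > ω(α)`. -/
def ghostValue (f : E.Gen → B) (α : E.StEdge) (i : ℕ) : B :=
  if h : i < E.weight α then f (.ghost α ⟨i, h⟩) else 0

theorem edgeValue_of_lt (f : E.Gen → B) {α : E.StEdge} {i : ℕ} (h : i < E.weight α) :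
    edgeValue f α i = f (.edge α ⟨i, h⟩) := dif_pos h

theorem edgeValue_of_le (f : E.Gen → B) {α : E.StEdge} {i : ℕ} (h : E.weight α ≤ i) :
    edgeValue f α i = 0 := dif_neg h.not_gt

theorem ghostValue_of_lt (f : E.Gen → B) {α : E.StEdge} {i : ℕ} (h : i < E.weight α) :
    ghostValue f α i = f (.ghost α ⟨i, h⟩) := dif_pos h

theorem ghostValue_of_le (f : E.Gen → B) {α : E.StEdge} {i : ℕ} (h : E.weight α ≤ i) :
    ghostValue f α i = 0 := dif_neg h.not_gt

theorem map_edgeValue (φ : B →ₙ+* C) (f : E.Gen → B) (α : E.StEdge) (i : ℕ) :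
    φ (edgeValue f α i) = edgeValue (fun x => φ (f x)) α i := by
  unfold edgeValue; split_ifs <;> simp

theorem map_ghostValue (φ : B →ₙ+* C) (f : E.Gen → B) (α : E.StEdge) (i : ℕ) :
    φ (ghostValue f α i) = ghostValue (fun x => φ (f x)) α i := by
  unfold ghostValue; split_ifs <;> simp

open Classical in
/-- A family of elements of a ring, indexed by the generators, that satisfies the defining
relations of the weighted Leavitt path algebra. The relations (1) for equal vertices and (2) are
combined in `src_mul` and `mul_tgt`. -/
structure IsLeavittFamily (f : E.Gen → B) : Prop where
  src_mul : ∀ x, f (.vertex x.src) * f x = f x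
  mul_tgt : ∀ x, f x * f (.vertex x.tgt) = f x
  vertex_mul_vertex_of_ne : ∀ v w, v ≠ w → f (.vertex v) * f (.vertex w) = 0
  edge_mul_ghost : ∀ v i j, i < E.maxWeight v → j < E.maxWeight v →
    ∑ α ∈ E.outEdges v, edgeValue f α i * ghostValue f α j = if i = j then f (.vertex v) else 0
  ghost_mul_edge : ∀ α β,
    ∑ i ∈ Finset.range (max (E.weight α) (E.weight β)), ghostValue f α i * edgeValue f β i =
      if α = β then f (.vertex (E.range α)) else 0

theorem IsLeavittFamily.map {f : E.Gen → B} (hf : IsLeavittFamily f) (φ : B →ₙ+* C) :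
    IsLeavittFamily fun x => φ (f x) where
  src_mul x := by rw [← map_mul, hf.src_mul]
  mul_tgt x := by rw [← map_mul, hf.mul_tgt]
  vertex_mul_vertex_of_ne v w hvw := by
    rw [← map_mul, hf.vertex_mul_vertex_of_ne v w hvw, map_zero]
  edge_mul_ghost v i j hi hj := by
    simp only [← map_edgeValue, ← map_ghostValue, ← map_mul, ← map_sum,
      hf.edge_mul_ghost v i j hi hj, apply_ite φ, map_zero]
  ghost_mul_edge α β := by
    simp only [← map_edgeValue, ← map_ghostValue, ← map_mul, ← map_sum, hf.ghost_mul_edge,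
      apply_ite φ, map_zero]

end IsLeavittFamily

section Quotient

variable {R : Type w} [Ring R]

theorem sub_mem_relIdeal {a b : FreeRRing R E.Gen} (h : E.Rel R a b) : a - b ∈ E.relIdeal R :=
  (TwoSidedIdeal.mem_sInf _).2 fun _ hI => hI.1 a b h

theorem smul_mem_relIdeal (r : R) {a : FreeRRing R E.Gen} (h : a ∈ E.relIdeal R) :
    r • a ∈ E.relIdeal R :=
  (TwoSidedIdeal.mem_sInf _).2 fun I hI => (hI.2 r a ((TwoSidedIdeal.mem_sInf _).1 h I hI)).1

namespace LeavittPathAlgebra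

variable (E R) in
/-- The projection of the free `R`-ring onto the weighted Leavitt path algebra. -/
noncomputable def proj : FreeRRing R E.Gen →ₙ+* E.LeavittPathAlgebra R where
  toFun a := (a : (E.relIdeal R).ringCon.Quotient)
  map_mul' _ _ := rfl
  map_zero' := rfl
  map_add' _ _ := rfl

theorem proj_surjective : Function.Surjective (proj E R) := Quotient.mk''_surjective

theorem proj_eq_proj_of_rel {a b : FreeRRing R E.Gen} (h : E.Rel R a b) :
    proj E R a = proj E R b :=
  (E.relIdeal R).ringCon.eq.2 (((E.relIdeal R).rel_iff a b).2 (sub_mem_relIdeal h))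

noncomputable instance : SMul R (E.LeavittPathAlgebra R) where
  smul r := Quotient.map' (r • ·) fun a b h => by
    have hr := smul_mem_relIdeal r (((E.relIdeal R).rel_iff a b).1 h)
    rw [smul_sub] at hr
    exact ((E.relIdeal R).rel_iff _ _).2 hr

theorem smul_proj (r : R) (a : FreeRRing R E.Gen) : r • proj E R a = proj E R (r • a) := rfl

noncomputable instance : Module R (E.LeavittPathAlgebra R) :=
  Function.Surjective.module R (AddMonoidHomClass.toAddMonoidHom (proj E R)) proj_surjective
    fun r a => (smul_proj r a).symm

instance : IsScalarTower R (E.LeavittPathAlgebra R) (E.LeavittPathAlgebra R) where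
  smul_assoc r a b := by
    obtain ⟨a, rfl⟩ := proj_surjective a
    obtain ⟨b, rfl⟩ := proj_surjective b
    rw [smul_proj, smul_eq_mul, smul_eq_mul, ← map_mul, ← map_mul, smul_proj, smul_mul_assoc]

variable (R) in
/-- The generators of the weighted Leavitt path algebra. -/
noncomputable def gen (x : E.Gen) : E.LeavittPathAlgebra R := proj E R (E.gen R x)

theorem gen_mul_smul (x : E.Gen) (r : R) (a : E.LeavittPathAlgebra R) :
    gen R x * r • a = r • (gen R x * a) := by
  obtain ⟨a, rfl⟩ := proj_surjective a
  have hfree : E.gen R x * r • a = r • (E.gen R x * a) := by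
    induction a using MonoidAlgebra.induction_linear with
    | zero => simp
    | add a b ha hb => rw [smul_add, mul_add, mul_add, smul_add, ha, hb]
    | single m s => simp [WeightedGraph.gen, MonoidAlgebra.single_mul_single]
  rw [gen, smul_proj, ← map_mul, ← map_mul, smul_proj, hfree]

theorem induction_on {P : E.LeavittPathAlgebra R → Prop} (a : E.LeavittPathAlgebra R)
    (add : ∀ a b, P a → P b → P (a + b)) (smul : ∀ (r : R) a, P a → P (r • a))
    (gen : ∀ x, P (gen R x)) (gen_mul : ∀ x a, P a → P (LeavittPathAlgebra.gen R x * a))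
    (zero : P 0) : P a := by
  obtain ⟨a, rfl⟩ := proj_surjective a
  induction a using MonoidAlgebra.induction_linear with
  | zero => rwa [map_zero]
  | add a b ha hb => rw [map_add]; exact add _ _ ha hb
  | single m r =>
    have hm : P (proj E R (MonoidAlgebra.single m 1)) := by
      induction m using FreeSemigroup.recOnMul with
      | ih1 x => exact gen x
      | ih2 x y _ hy =>
        have hxy := gen_mul x _ hy
        rwa [LeavittPathAlgebra.gen, ← map_mul, WeightedGraph.gen, MonoidAlgebra.single_mul_single,
          mul_one] at hxy
    have hr := smul r _ hm
    rwa [smul_proj, MonoidAlgebra.smul_single, smul_eq_mul, mul_one] at hr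

theorem proj_vtx (v : E.Vertex) : proj E R (E.vtx R v) = gen R (.vertex v) := rfl

theorem proj_edg (α : E.StEdge) (i : ℕ) : proj E R (E.edg R α i) = edgeValue (gen R) α i :=
  map_edgeValue (proj E R) (E.gen R) α i

theorem proj_gst (α : E.StEdge) (i : ℕ) : proj E R (E.gst R α i) = ghostValue (gen R) α i :=
  map_ghostValue (proj E R) (E.gen R) α i

variable (E R) in
theorem isLeavittFamily_gen : IsLeavittFamily (gen R (E := E)) where
  src_mul x := by
    have h : E.Rel R (E.vtx R x.src * E.gen R x) (E.gen R x) := by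
      rcases x with v | ⟨α, i⟩ | ⟨α, i⟩
      · simpa [vtx, Gen.src, Gen.tgt] using Rel.vertex_mul_vertex v v
      · simpa [edg, Gen.src, Gen.tgt] using Rel.source_mul_edge α i i.2
      · simpa [gst, Gen.src, Gen.tgt] using Rel.range_mul_ghost α i i.2
    exact (map_mul (proj E R) _ _).symm.trans (proj_eq_proj_of_rel h)
  mul_tgt x := by
    have h : E.Rel R (E.gen R x * E.vtx R x.tgt) (E.gen R x) := by
      rcases x with v | ⟨α, i⟩ | ⟨α, i⟩
      · simpa [vtx, Gen.src, Gen.tgt] using Rel.vertex_mul_vertex v v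
      · simpa [edg, Gen.src, Gen.tgt] using Rel.edge_mul_range α i i.2
      · simpa [gst, Gen.src, Gen.tgt] using Rel.ghost_mul_source α i i.2
    exact (map_mul (proj E R) _ _).symm.trans (proj_eq_proj_of_rel h)
  vertex_mul_vertex_of_ne v w hvw := by
    simpa [hvw, proj_vtx] using proj_eq_proj_of_rel (.vertex_mul_vertex (R := R) v w)
  edge_mul_ghost v i j hi hj := by
    have h := proj_eq_proj_of_rel (.edge_mul_ghost (R := R) v i j hi hj)
    simpa only [map_sum, map_mul, proj_vtx, proj_edg, proj_gst, apply_ite (proj E R),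
      map_zero] using h
  ghost_mul_edge α β := by
    have h := proj_eq_proj_of_rel (.ghost_mul_edge (R := R) α β)
    simpa only [map_sum, map_mul, proj_vtx, proj_edg, proj_gst, apply_ite (proj E R),
      map_zero] using h

section Lift

variable {B : Type*} [Ring B] {c : R →+* B} {f : E.Gen → B}

theorem freeRRingLift_eq_of_rel (hcf : ∀ r x, Commute (c r) (f x)) (hf : IsLeavittFamily f)
    {a b : FreeRRing R E.Gen} (h : E.Rel R a b) :
    freeRRingLift c f hcf a = freeRRingLift c f hcf b := by
  have map_gen (x : E.Gen) : freeRRingLift c f hcf (E.gen R x) = f x := by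
    simp [WeightedGraph.gen, freeRRingLift_single]
  have map_vtx (v : E.Vertex) : freeRRingLift c f hcf (E.vtx R v) = f (.vertex v) := map_gen _
  have map_edg (α i) : freeRRingLift c f hcf (E.edg R α i) = edgeValue f α i := by
    exact (map_edgeValue (freeRRingLift c f hcf) (E.gen R) α i).trans (by simp only [map_gen])
  have map_gst (α i) : freeRRingLift c f hcf (E.gst R α i) = ghostValue f α i := by
    exact (map_ghostValue (freeRRingLift c f hcf) (E.gen R) α i).trans (by simp only [map_gen])
  cases h with
  | vertex_mul_vertex v w =>
    split_ifs with hvw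
    · subst hvw
      simpa only [map_mul, map_vtx, Gen.src] using hf.src_mul (.vertex v)
    · simpa only [map_mul, map_vtx, map_zero] using hf.vertex_mul_vertex_of_ne v w hvw
  | source_mul_edge α i hi =>
    simpa only [map_mul, map_vtx, map_edg, edgeValue_of_lt f hi, Gen.src] using
      hf.src_mul (.edge α ⟨i, hi⟩)
  | edge_mul_range α i hi =>
    simpa only [map_mul, map_vtx, map_edg, edgeValue_of_lt f hi, Gen.tgt] using
      hf.mul_tgt (.edge α ⟨i, hi⟩)
  | range_mul_ghost α i hi =>
    simpa only [map_mul, map_vtx, map_gst, ghostValue_of_lt f hi, Gen.src] using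
      hf.src_mul (.ghost α ⟨i, hi⟩)
  | ghost_mul_source α i hi =>
    simpa only [map_mul, map_vtx, map_gst, ghostValue_of_lt f hi, Gen.tgt] using
      hf.mul_tgt (.ghost α ⟨i, hi⟩)
  | edge_mul_ghost v i j hi hj =>
    simpa only [map_sum, map_mul, map_edg, map_gst, apply_ite (freeRRingLift c f hcf), map_vtx,
      map_zero] using hf.edge_mul_ghost v i j hi hj
  | ghost_mul_edge α β =>
    simpa only [map_sum, map_mul, map_edg, map_gst, apply_ite (freeRRingLift c f hcf), map_vtx,
      map_zero] using hf.ghost_mul_edge α β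

theorem freeRRingLift_eq_zero_of_mem_relIdeal (hcf : ∀ r x, Commute (c r) (f x))
    (hf : IsLeavittFamily f) {a : FreeRRing R E.Gen} (ha : a ∈ E.relIdeal R) :
    freeRRingLift c f hcf a = 0 := by
  refine TwoSidedIdeal.mem_ker _ |>.1 <| (TwoSidedIdeal.mem_sInf _).1 ha
    (TwoSidedIdeal.ker (freeRRingLift c f hcf)) ⟨fun a b hab => ?_, fun r a ha => ?_⟩
  · rw [TwoSidedIdeal.mem_ker, map_sub, freeRRingLift_eq_of_rel hcf hf hab, sub_self]
  · simp only [TwoSidedIdeal.mem_ker] at ha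
    simp [TwoSidedIdeal.mem_ker, freeRRingLift_smul, freeRRingLift_op_smul, ha]

/-- The universal property of the weighted Leavitt path algebra, for unital target rings. -/
noncomputable def lift (hcf : ∀ r x, Commute (c r) (f x)) (hf : IsLeavittFamily f) :
    E.LeavittPathAlgebra R →ₙ+* B where
  toFun := Quotient.lift (freeRRingLift c f hcf) fun a b hab => by
    rw [← sub_eq_zero, ← map_sub]
    exact freeRRingLift_eq_zero_of_mem_relIdeal hcf hf (((E.relIdeal R).rel_iff a b).1 hab)
  map_zero' := map_zero (freeRRingLift c f hcf)
  map_mul' := proj_surjective.forall₂.2 (map_mul (freeRRingLift c f hcf))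
  map_add' := proj_surjective.forall₂.2 (map_add (freeRRingLift c f hcf))

variable (hcf : ∀ r x, Commute (c r) (f x)) (hf : IsLeavittFamily f)

theorem lift_smul (r : R) (a : E.LeavittPathAlgebra R) :
    lift hcf hf (r • a) = c r * lift hcf hf a := by
  obtain ⟨a, rfl⟩ := proj_surjective a
  exact freeRRingLift_smul hcf r a

theorem lift_gen (x : E.Gen) : lift hcf hf (gen R x) = f x :=
  (freeRRingLift_single hcf _ _).trans (by simp)

end Lift

end LeavittPathAlgebra

end Quotient

end WeightedGraph

/-- Left multiplication, as a homomorphism into the ring of additive endomorphisms. -/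
def leftRegular (A : Type*) [NonUnitalRing A] : A →ₙ+* AddMonoid.End A :=
  { AddMonoidHom.mul with map_mul' := fun a b => AddMonoidHom.ext (mul_assoc a b) }

namespace WeightedGraph

variable {R : Type w} [Ring R] {E : WeightedGraph.{u, v}}

namespace LeavittPathAlgebra

theorem commute_leftRegular_gen (r : R) (x : E.Gen) :
    Commute (Module.toAddMonoidEnd R (E.LeavittPathAlgebra R) r) (leftRegular _ (gen R x)) :=
  AddMonoidHom.ext fun a => (gen_mul_smul x r a).symm

theorem apply_lift_eq_leftRegular {B : Type*} [Ring B] {c : R →+* B} {f : E.Gen → B}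
    (hcf : ∀ r x, Commute (c r) (f x)) (hf : IsLeavittFamily f)
    {ψ : B →+* AddMonoid.End (E.LeavittPathAlgebra R)}
    (hψc : ∀ r, ψ (c r) = Module.toAddMonoidEnd R _ r)
    (hψf : ∀ x, ψ (f x) = leftRegular _ (gen R x)) (a : E.LeavittPathAlgebra R) :
    ψ (lift hcf hf a) = leftRegular _ a := by
  induction a using induction_on with
  | add a b ha hb => simp only [map_add, ha, hb]
  | smul r a ha =>
    rw [lift_smul, map_mul, ha, hψc]
    exact AddMonoidHom.ext fun b => (smul_mul_assoc r a b).symm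
  | gen x => rw [lift_gen, hψf]
  | gen_mul x a ha => simp only [map_mul, ha, lift_gen, hψf]
  | zero => simp only [map_zero]

section Rose

variable [Subsingleton E.Vertex]

theorem vertex_mul (v : E.Vertex) (a : E.LeavittPathAlgebra R) : gen R (.vertex v) * a = a := by
  induction a using induction_on with
  | add a b ha hb => rw [mul_add, ha, hb]
  | smul r a ha => rw [gen_mul_smul, ha]
  | gen x => rw [Subsingleton.elim v x.src, (isLeavittFamily_gen E R).src_mul]
  | gen_mul x a _ =>
    rw [← mul_assoc, Subsingleton.elim v x.src, (isLeavittFamily_gen E R).src_mul]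
  | zero => rw [mul_zero]

theorem mul_vertex (v : E.Vertex) (a : E.LeavittPathAlgebra R) : a * gen R (.vertex v) = a := by
  induction a using induction_on with
  | add a b ha hb => rw [add_mul, ha, hb]
  | smul r a ha => rw [smul_mul_assoc, ha]
  | gen x => rw [Subsingleton.elim v x.tgt, (isLeavittFamily_gen E R).mul_tgt]
  | gen_mul x a ha => rw [mul_assoc, ha]
  | zero => rw [zero_mul]

theorem leftRegular_vertex (v : E.Vertex) :
    leftRegular (E.LeavittPathAlgebra R) (gen R (.vertex v)) = 1 :=
  AddMonoidHom.ext (vertex_mul v)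

theorem isRingDomain_of_apply_eq_leftRegular (v : E.Vertex) {B : Type*} [Ring B] [IsDomain B]
    {c : R →+* B} {f : E.Gen → B} (hcf : ∀ r x, Commute (c r) (f x)) (hf : IsLeavittFamily f)
    (hfv : f (.vertex v) = 1) (ψ : B →+* AddMonoid.End (E.LeavittPathAlgebra R))
    (hψc : ∀ r, ψ (c r) = Module.toAddMonoidEnd R _ r)
    (hψf : ∀ x, ψ (f x) = leftRegular _ (gen R x)) : IsRingDomain (E.LeavittPathAlgebra R) := by
  have eq_zero_of_lift_eq_zero {a : E.LeavittPathAlgebra R} (ha : lift hcf hf a = 0) : a = 0 := by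
    have leftRegular_eq_zero : leftRegular _ a = 0 := by
      rw [← apply_lift_eq_leftRegular hcf hf hψc hψf, ha, map_zero]
    exact (mul_vertex v a).symm.trans (DFunLike.congr_fun leftRegular_eq_zero _)
  have lift_vertex : lift hcf hf (gen R (.vertex v)) = 1 := (lift_gen hcf hf _).trans hfv
  refine ⟨⟨gen R (.vertex v), 0, fun h => ?_⟩, fun a b hab => ?_⟩
  · rw [h, map_zero] at lift_vertex
    exact zero_ne_one lift_vertex
  · have lift_mul_lift : lift hcf hf a * lift hcf hf b = 0 := by rw [← map_mul, hab, map_zero]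
    exact (mul_eq_zero.1 lift_mul_lift).imp eq_zero_of_lift_eq_zero eq_zero_of_lift_eq_zero

end Rose

end LeavittPathAlgebra

section Petal

variable {B : Type*} [NonUnitalRing B] {f : E.Gen → B} (hf : IsLeavittFamily f)

include hf

theorem IsLeavittFamily.edge_mul_ghost_of_subsingleton [Subsingleton E.StEdge] (α : E.StEdge) :
    f (.edge α ⟨0, E.weight_pos α⟩) * f (.ghost α ⟨0, E.weight_pos α⟩) =
      f (.vertex (E.source α)) := by
  have maxWeight_pos := (E.weight_pos α).trans_le (weight_le_maxWeight α)
  have h := hf.edge_mul_ghost (E.source α) 0 0 maxWeight_pos maxWeight_pos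
  rwa [Finset.sum_eq_single_of_mem α (mem_outEdges.2 rfl)
    fun β _ hβ => absurd (Subsingleton.elim β α) hβ, edgeValue_of_lt _ (E.weight_pos α),
    ghostValue_of_lt _ (E.weight_pos α), if_pos rfl] at h

theorem IsLeavittFamily.ghost_mul_edge_of_weight_eq_one {α : E.StEdge} (hα : E.weight α = 1) :
    f (.ghost α ⟨0, E.weight_pos α⟩) * f (.edge α ⟨0, E.weight_pos α⟩) =
      f (.vertex (E.range α)) := by
  have h := hf.ghost_mul_edge α α
  rwa [max_self, hα, Finset.sum_range_one, edgeValue_of_lt _ (E.weight_pos α),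
    ghostValue_of_lt _ (E.weight_pos α), if_pos rfl] at h

end Petal

section Rose

variable [Subsingleton E.Vertex] {B : Type*} [Ring B]

theorem mem_outEdges_of_subsingleton (v : E.Vertex) (α : E.StEdge) : α ∈ E.outEdges v :=
  mem_outEdges.2 (Subsingleton.elim _ _)

theorem weight_le_maxWeight_of_subsingleton (v : E.Vertex) (α : E.StEdge) :
    E.weight α ≤ E.maxWeight v :=
  Finset.le_sup (f := E.weight) (mem_outEdges_of_subsingleton v α)

theorem outEdges_eq_univ [Fintype E.StEdge] (v : E.Vertex) : E.outEdges v = Finset.univ :=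
  Finset.eq_univ_of_forall (mem_outEdges_of_subsingleton v)

theorem sum_range_max_eq_sum_fin (v : E.Vertex) (f : E.Gen → B) (α β : E.StEdge) :
    ∑ i ∈ Finset.range (max (E.weight α) (E.weight β)), ghostValue f α i * edgeValue f β i =
      ∑ i : Fin (E.maxWeight v), ghostValue f α i * edgeValue f β i := by
  rw [Fin.sum_univ_eq_sum_range fun i => ghostValue f α i * edgeValue f β i]
  refine Finset.sum_subset (Finset.range_subset_range.2 <| max_le
    (weight_le_maxWeight_of_subsingleton v α) (weight_le_maxWeight_of_subsingleton v β))
    fun i _ hi => ?_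
  rw [Finset.mem_range, not_lt] at hi
  rw [ghostValue_of_le f (le_of_max_le_left hi), zero_mul]

section LVRose

variable (v : E.Vertex)

/-- The block matrix with blocks `(α_i)` and `(α_i*)` formed by a family of values of the generators
of a rose with vertex `v`. Its rows and columns are indexed by the indices `i` below the maximal
weight together with the petals `α`. -/
noncomputable def roseMatrix (f : E.Gen → B) :
    Matrix (Fin (E.maxWeight v) ⊕ E.StEdge) (Fin (E.maxWeight v) ⊕ E.StEdge) B :=
  Matrix.fromBlocks 0 (.of fun i α => edgeValue f α i) (.of fun α i => ghostValue f α i) 0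

/-- The values of the generators of a rose with vertex `v` given by the entries of a matrix, the
vertex being sent to `1`. -/
noncomputable def roseFamily
    (Z : Matrix (Fin (E.maxWeight v) ⊕ E.StEdge) (Fin (E.maxWeight v) ⊕ E.StEdge) B) : E.Gen → B
  | .vertex _ => 1
  | .edge α i => Z (.inl (i.castLE (weight_le_maxWeight_of_subsingleton v α))) (.inr α)
  | .ghost α i => Z (.inr α) (.inl (i.castLE (weight_le_maxWeight_of_subsingleton v α)))

variable {v} {α₀ : E.StEdge}

/-- The bipartite graph with an arrow for each edge and for each ghost edge of a rose. The hubs are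
the first index and a petal of maximal weight. -/
noncomputable def roseGraph (hα₀ : E.weight α₀ = E.maxWeight v) :
    HubGraph (Fin (E.maxWeight v) ⊕ E.StEdge) :=
  .ofRel (fun i α => (i : ℕ) < E.weight α) ⟨0, hα₀ ▸ E.weight_pos α₀⟩ α₀ E.weight_pos
    fun i => i.2.trans_eq hα₀.symm

omit [Subsingleton E.Vertex] in
theorem commute_roseMatrix {b : B} {f : E.Gen → B} (hbf : ∀ x, Commute b (f x)) :
    ∀ p q, Commute b (roseMatrix v f p q)
  | .inl _, .inl _ => .zero_right b
  | .inl i, .inr α => by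
    change Commute b (edgeValue f α i)
    unfold edgeValue
    split_ifs
    exacts [hbf _, .zero_right b]
  | .inr α, .inl i => by
    change Commute b (ghostValue f α i)
    unfold ghostValue
    split_ifs
    exacts [hbf _, .zero_right b]
  | .inr _, .inr _ => .zero_right b

theorem commute_roseFamily {b : B}
    {Z : Matrix (Fin (E.maxWeight v) ⊕ E.StEdge) (Fin (E.maxWeight v) ⊕ E.StEdge) B}
    (hbZ : ∀ p q, Commute b (Z p q)) : ∀ x, Commute b (roseFamily v Z x)
  | .vertex _ => .one_right b
  | .edge _ _ => hbZ _ _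
  | .ghost _ _ => hbZ _ _

variable [Fintype E.StEdge] [DecidableEq E.StEdge]

theorem isLeavittMatrix_roseMatrix (hα₀ : E.weight α₀ = E.maxWeight v) {f : E.Gen → B}
    (hf : IsLeavittFamily f) (hfv : f (.vertex v) = 1) :
    (roseGraph hα₀).IsLeavittMatrix (roseMatrix v f) := by
  apply HubGraph.isLeavittMatrix_ofRel_fromBlocks
  · exact fun i α hiα => edgeValue_of_le f (not_lt.1 hiα)
  · exact fun i α hiα => ghostValue_of_le f (not_lt.1 hiα)
  · ext i j
    have h := hf.edge_mul_ghost v i j i.2 j.2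
    simpa [Matrix.mul_apply, Matrix.one_apply, outEdges_eq_univ, hfv, Fin.ext_iff] using h
  · ext α β
    have h := hf.ghost_mul_edge α β
    rw [sum_range_max_eq_sum_fin v, Subsingleton.elim (E.range α) v, hfv] at h
    rw [Matrix.mul_apply, Matrix.one_apply]
    exact h.trans (by split_ifs <;> rfl)

section RoseFamily

variable {hα₀ : E.weight α₀ = E.maxWeight v}
  {Z : Matrix (Fin (E.maxWeight v) ⊕ E.StEdge) (Fin (E.maxWeight v) ⊕ E.StEdge) B}
  (hZ : (roseGraph hα₀).IsLeavittMatrix Z)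

include hZ

theorem edgeValue_roseFamily (α : E.StEdge) (i : Fin (E.maxWeight v)) :
    edgeValue (roseFamily v Z) α i = Z (.inl i) (.inr α) := by
  by_cases hi : i < E.weight α
  · exact edgeValue_of_lt _ hi
  · rw [edgeValue_of_le _ (not_lt.1 hi), hZ.eq_zero (.inl i) (.inr α) hi]

theorem ghostValue_roseFamily (α : E.StEdge) (i : Fin (E.maxWeight v)) :
    ghostValue (roseFamily v Z) α i = Z (.inr α) (.inl i) := by
  by_cases hi : i < E.weight α
  · exact ghostValue_of_lt _ hi
  · rw [ghostValue_of_le _ (not_lt.1 hi), hZ.eq_zero (.inr α) (.inl i) hi]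

theorem isLeavittFamily_roseFamily : IsLeavittFamily (roseFamily v Z) where
  src_mul _ := one_mul _
  mul_tgt _ := mul_one _
  vertex_mul_vertex_of_ne v w hvw := absurd (Subsingleton.elim v w) hvw
  edge_mul_ghost w i j hi hj := by
    obtain rfl := Subsingleton.elim v w
    have h := congr_fun₂ hZ.blocks_mul.1 ⟨i, hi⟩ ⟨j, hj⟩
    rw [Matrix.mul_apply, Matrix.one_apply] at h
    rw [outEdges_eq_univ]
    convert h using 1
    · exact Finset.sum_congr rfl fun α _ => congr_arg₂ _ (edgeValue_roseFamily hZ α ⟨i, hi⟩)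
        (ghostValue_roseFamily hZ α ⟨j, hj⟩)
    · simp [roseFamily]
  ghost_mul_edge α β := by
    have h := congr_fun₂ hZ.blocks_mul.2 α β
    rw [Matrix.mul_apply, Matrix.one_apply] at h
    simp only [sum_range_max_eq_sum_fin v, edgeValue_roseFamily hZ, ghostValue_roseFamily hZ]
    exact h.trans (by split_ifs <;> rfl)

end RoseFamily

end LVRose

section Petal

/-- The values of the generators of an unweighted rose with at most one petal given by an element
for the petal and an element for its ghost, the vertex being sent to `1`. -/
def petalFamily (t t' : B) : E.Gen → B
  | .vertex _ => 1
  | .edge _ _ => t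
  | .ghost _ _ => t'

theorem isLeavittFamily_petalFamily [Subsingleton E.StEdge] (hE : E.IsUnweighted) {t t' : B}
    (htt' : t * t' = 1) (ht't : t' * t = 1) : IsLeavittFamily (E := E) (petalFamily t t') where
  src_mul _ := one_mul _
  mul_tgt _ := mul_one _
  vertex_mul_vertex_of_ne v w hvw := absurd (Subsingleton.elim v w) hvw
  edge_mul_ghost v i j hi hj := by
    obtain ⟨α, hα, -⟩ := Finset.lt_sup_iff.1 hi
    have maxWeight_le : E.maxWeight v ≤ 1 := Finset.sup_le fun β _ => (hE β).le
    obtain rfl : i = 0 := by lia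
    obtain rfl : j = 0 := by lia
    rw [Finset.sum_eq_single_of_mem α hα fun β _ hβ => absurd (Subsingleton.elim β α) hβ,
      edgeValue_of_lt _ (E.weight_pos α), ghostValue_of_lt _ (E.weight_pos α), if_pos rfl]
    exact htt'
  ghost_mul_edge α β := by
    rw [Subsingleton.elim β α, max_self, hE α, Finset.sum_range_one,
      edgeValue_of_lt _ (E.weight_pos α), ghostValue_of_lt _ (E.weight_pos α), if_pos rfl]
    exact ht't

end Petal

namespace LeavittPathAlgebra

section LVRose

theorem isRingDomain_of_two_le_weight [IsDomain R] (v : E.Vertex) (hE : ∀ α, 2 ≤ E.weight α)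
    {α₀ α₁ : E.StEdge} (hα : α₁ ≠ α₀) (hα₀ : E.weight α₀ = E.maxWeight v)
    (hα₁ : E.weight α₁ = E.maxWeight v) : IsRingDomain (E.LeavittPathAlgebra R) := by
  classical
  let _ : Fintype E.StEdge := ⟨E.outEdges v, mem_outEdges_of_subsingleton v⟩
  let G := roseGraph hα₀
  have isDomain_leavittRing : IsDomain (G.LeavittRing R) :=
    HubGraph.LeavittRing.isDomain <| HubGraph.hasTwoHubs_ofRel _ _ _ _ _
      (i₁ := ⟨1, hα₀ ▸ hE α₀⟩) (by simp) hα hE fun i => i.2.trans_eq hα₁.symm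
  have isLeavittMatrix_leftRegular := isLeavittMatrix_roseMatrix hα₀
    ((isLeavittFamily_gen E R).map (leftRegular _)) (leftRegular_vertex v)
  let ψ := HubGraph.LeavittRing.lift G (Module.toAddMonoidEnd R _) isLeavittMatrix_leftRegular
    fun r => commute_roseMatrix (commute_leftRegular_gen r)
  refine isRingDomain_of_apply_eq_leftRegular v (c := HubGraph.LeavittRing.const G R)
    (fun r => commute_roseFamily (HubGraph.LeavittRing.commute_const_arrow G R r))
    (isLeavittFamily_roseFamily (HubGraph.LeavittRing.isLeavittMatrix_arrow G R)) rfl ψ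
    (HubGraph.LeavittRing.lift_const G _ _ _) ?_
  let f : E.Gen → AddMonoid.End (E.LeavittPathAlgebra R) := fun x => leftRegular _ (gen R x)
  rintro (w | ⟨α, i⟩ | ⟨α, i⟩)
  · exact (map_one ψ).trans (leftRegular_vertex w).symm
  · exact (HubGraph.LeavittRing.lift_arrow ..).trans (edgeValue_of_lt f i.2)
  · exact (HubGraph.LeavittRing.lift_arrow ..).trans (ghostValue_of_lt f i.2)

end LVRose

section Petal

variable [Subsingleton E.StEdge] (hE : E.IsUnweighted)

include hE

theorem exists_unit_eq_leftRegular : ∃ u : (AddMonoid.End (E.LeavittPathAlgebra R))ˣ,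
    (∀ r, Commute (Module.toAddMonoidEnd R (E.LeavittPathAlgebra R) r) u) ∧
    (∀ (α : E.StEdge) i, leftRegular _ (gen R (.edge α i)) = u) ∧
    ∀ (α : E.StEdge) i, leftRegular _ (gen R (.ghost α i)) = ↑(u⁻¹) := by
  rcases isEmpty_or_nonempty E.StEdge with _ | ⟨⟨α⟩⟩
  · exact ⟨1, fun r => .one_right _, isEmptyElim, isEmptyElim⟩
  have hf := isLeavittFamily_gen E R
  have fin_eq (i : Fin (E.weight α)) : i = ⟨0, E.weight_pos α⟩ :=
    Fin.ext (Nat.lt_one_iff.1 (i.2.trans_eq (hE α)))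
  refine ⟨⟨leftRegular _ (gen R (.edge α ⟨0, E.weight_pos α⟩)),
    leftRegular _ (gen R (.ghost α ⟨0, E.weight_pos α⟩)), ?_, ?_⟩,
    fun r => commute_leftRegular_gen r _, fun β i => ?_, fun β i => ?_⟩
  · rw [← map_mul, hf.edge_mul_ghost_of_subsingleton, leftRegular_vertex]
  · rw [← map_mul, hf.ghost_mul_edge_of_weight_eq_one (hE α), leftRegular_vertex]
  · obtain rfl := Subsingleton.elim α β
    rw [fin_eq i]
  · obtain rfl := Subsingleton.elim α β
    rw [fin_eq i]
    rfl

open LaurentPolynomial in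
theorem isRingDomain_of_isUnweighted [IsDomain R] (v : E.Vertex) :
    IsRingDomain (E.LeavittPathAlgebra R) := by
  obtain ⟨u, commute_u, edge_eq, ghost_eq⟩ := exists_unit_eq_leftRegular (R := R) hE
  let ψ : R[T;T⁻¹] →+* AddMonoid.End (E.LeavittPathAlgebra R) :=
    AddMonoidAlgebra.liftNCRingHom (Module.toAddMonoidEnd R _)
      ((Units.coeHom _).comp (zpowersHom _ u)) fun r n => (commute_u r).units_zpow_right n.toAdd
  have ψ_single (n : ℤ) (r : R) :
      ψ (.single n r) = Module.toAddMonoidEnd R (E.LeavittPathAlgebra R) r * ↑(u ^ n) :=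
    AddMonoidAlgebra.liftNC_single ..
  refine isRingDomain_of_apply_eq_leftRegular v (c := C)
    (f := petalFamily (T 1) (T (-1))) ?_ (isLeavittFamily_petalFamily hE ?_ ?_) rfl ψ ?_ ?_
  · rintro r (_ | _ | _)
    exacts [.one_right _, (commute_T _ _).symm, (commute_T _ _).symm]
  · rw [← T_add, add_neg_cancel, T_zero]
  · rw [← T_add, neg_add_cancel, T_zero]
  · intro r
    exact (ψ_single 0 r).trans (by simp)
  · rintro (w | ⟨α, i⟩ | ⟨α, i⟩)
    · exact (map_one ψ).trans (leftRegular_vertex w).symm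
    · exact (ψ_single 1 1).trans (by simp [edge_eq])
    · exact (ψ_single (-1) 1).trans (by simp [ghost_eq])

end Petal

end LeavittPathAlgebra

end Rose

end WeightedGraph

/-- A finite family of isometries `S a` with adjoints `S' a` satisfying the relations of a Cuntz
algebra. -/
structure IsCuntzFamily {T A : Type*} [Ring A] (s : Finset T) (S S' : T → A) : Prop where
  mul_self : ∀ a ∈ s, S' a * S a = 1
  mul_of_ne : ∀ a ∈ s, ∀ b ∈ s, a ≠ b → S' a * S b = 0
  sum_mul : ∑ a ∈ s, S a * S' a = 1

theorem exists_isCuntzFamily (R : Type*) [Ring R] {T : Type*} {s : Finset T} (hs : s.Nonempty) :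
    ∃ S S' : T → Module.End R (ℕ → R), IsCuntzFamily s S S' := by
  classical
  have := hs.to_subtype
  obtain ⟨ε⟩ : Nonempty (s × ℕ ≃ ℕ) := nonempty_equiv_of_countable
  let e : (ℕ → R) ≃ₗ[R] s → ℕ → R :=
    (LinearEquiv.funCongrLeft R R ε).trans (LinearEquiv.curry R R s ℕ)
  let S (a : T) : Module.End R (ℕ → R) :=
    if h : a ∈ s then e.symm ∘ₗ LinearMap.single R (fun _ : s => ℕ → R) ⟨a, h⟩ else 0
  let S' (a : T) : Module.End R (ℕ → R) :=
    if h : a ∈ s then LinearMap.proj (φ := fun _ : s => ℕ → R) ⟨a, h⟩ ∘ₗ e else 0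
  refine ⟨S, S', fun a ha => ?_, fun a ha b hb hab => ?_, ?_⟩
  · ext : 1; simp [S, S', ha]
  · ext : 1; simp [S, S', ha, hb, hab, Subtype.ext_iff]
  · refine LinearMap.ext fun m => ?_
    rw [← s.sum_coe_sort, LinearMap.sum_apply]
    have hsum : ∑ a : s, Pi.single a (e m a) = e m := Finset.univ_sum_single (e m)
    simpa [S, S'] using congr_arg e.symm hsum

section BlockEnd

variable {R N V : Type*} [Ring R] [AddCommGroup N] [Module R N]

open Classical in
/-- The endomorphism of a power `V → N` with a single non-zero matrix block, in row `u` and column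
`v`. -/
noncomputable def blockEnd (u v : V) : Module.End R N →+ Module.End R (V → N) :=
  .mk' (fun f => LinearMap.single R (fun _ => N) u ∘ₗ f ∘ₗ LinearMap.proj v)
    fun f g => by ext : 1; simp [Pi.single_add]

theorem blockEnd_mul_blockEnd (u v w : V) (f g : Module.End R N) :
    blockEnd u v f * blockEnd v w g = blockEnd u w (f * g) := by
  ext : 1; simp [blockEnd]

theorem blockEnd_mul_blockEnd_of_ne (u w : V) {v v' : V} (h : v ≠ v') (f g : Module.End R N) :
    blockEnd u v f * blockEnd v' w g = 0 := by
  ext : 1; simp [blockEnd, h]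

end BlockEnd

namespace WeightedGraph

variable {E : WeightedGraph.{u, v}}

section BlockFamily

variable {R : Type w} {N : Type*} [Ring R] [AddCommGroup N] [Module R N]
  (S S' : E.Vertex → ℕ → E.StEdge → Module.End R N) (Q Q' : E.StEdge → ℕ → Module.End R N)

/-- The values of the generators on `E.Vertex → N` where a vertex is the projection to its own
factor, and `α_{i+1}` and `α_{i+1}*` act between the factors of the range and of the source of `α`
by `S_{i,α} Q'_{α,i}` and `Q_{α,i} S'_{i,α}`. -/
noncomputable def blockFamily : E.Gen → Module.End R (E.Vertex → N)
  | .vertex v => blockEnd v v 1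
  | .edge α i => blockEnd (E.source α) (E.range α) (S (E.source α) i α * Q' α i)
  | .ghost α i => blockEnd (E.range α) (E.source α) (Q α i * S' (E.source α) i α)

variable {S S' Q Q'}
  (hS : ∀ v i, i < E.maxWeight v →
    IsCuntzFamily {α ∈ E.outEdges v | i < E.weight α} (S v i) (S' v i))
  (hQ : ∀ α, IsCuntzFamily (Finset.range (E.weight α)) (Q α) (Q' α))

include hQ in
theorem edgeValue_mul_ghostValue_blockFamily (α : E.StEdge) (i j : ℕ) :
    edgeValue (blockFamily S S' Q Q') α i * ghostValue (blockFamily S S' Q Q') α j =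
      if i = j ∧ i < E.weight α then blockEnd (E.source α) (E.source α)
        (S (E.source α) i α * S' (E.source α) i α) else 0 := by
  by_cases hi : i < E.weight α; swap
  · rw [edgeValue_of_le _ (not_lt.1 hi), zero_mul, if_neg fun h => hi h.2]
  by_cases hj : j < E.weight α; swap
  · rw [ghostValue_of_le _ (not_lt.1 hj), mul_zero, if_neg (by rintro ⟨rfl, h⟩; exact hj h)]
  rw [edgeValue_of_lt _ hi, ghostValue_of_lt _ hj, blockFamily, blockFamily, blockEnd_mul_blockEnd,
    mul_assoc, ← mul_assoc (Q' α i)]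
  have hi' := Finset.mem_range.2 hi
  rcases eq_or_ne i j with rfl | hij
  · rw [(hQ α).mul_self i hi', one_mul, if_pos ⟨rfl, hi⟩]
  · rw [(hQ α).mul_of_ne i hi' j (Finset.mem_range.2 hj) hij, zero_mul, mul_zero, map_zero,
      if_neg fun h => hij h.1]

include hS in
open Classical in
theorem ghostValue_mul_edgeValue_blockFamily (α β : E.StEdge) (i : ℕ) :
    ghostValue (blockFamily S S' Q Q') α i * edgeValue (blockFamily S S' Q Q') β i =
      if α = β ∧ i < E.weight α then blockEnd (E.range α) (E.range α) (Q α i * Q' α i) else 0 := by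
  by_cases hα : i < E.weight α; swap
  · rw [ghostValue_of_le _ (not_lt.1 hα), zero_mul, if_neg fun h => hα h.2]
  by_cases hβ : i < E.weight β; swap
  · rw [edgeValue_of_le _ (not_lt.1 hβ), mul_zero, if_neg (by rintro ⟨rfl, h⟩; exact hβ h)]
  have mem_filter {γ v} (hγ : i < E.weight γ) (h : E.source γ = v) :
      γ ∈ (E.outEdges v).filter (i < E.weight ·) :=
    Finset.mem_filter.2 ⟨mem_outEdges.2 h, hγ⟩
  have hS := hS (E.source α) i (hα.trans_le (weight_le_maxWeight α))
  rw [edgeValue_of_lt _ hβ, ghostValue_of_lt _ hα, blockFamily, blockFamily]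
  rcases ne_or_eq (E.source α) (E.source β) with hs | hs
  · rw [blockEnd_mul_blockEnd_of_ne _ _ hs, if_neg fun h => hs (congr_arg E.source h.1)]
  rw [← hs, blockEnd_mul_blockEnd, mul_assoc, ← mul_assoc (S' _ _ _)]
  rcases eq_or_ne α β with rfl | hαβ
  · rw [hS.mul_self α (mem_filter hα rfl), one_mul, if_pos ⟨rfl, hα⟩]
  · rw [hS.mul_of_ne α (mem_filter hα rfl) β (mem_filter hβ hs.symm) hαβ, zero_mul, mul_zero,
      map_zero, if_neg fun h => hαβ h.1]

include hS hQ

theorem isLeavittFamily_blockFamily : IsLeavittFamily (blockFamily S S' Q Q') where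
  src_mul := by
    rintro (v | ⟨α, i⟩ | ⟨α, i⟩) <;> exact (blockEnd_mul_blockEnd ..).trans (by rw [one_mul]; rfl)
  mul_tgt := by
    rintro (v | ⟨α, i⟩ | ⟨α, i⟩) <;> exact (blockEnd_mul_blockEnd ..).trans (by rw [mul_one]; rfl)
  vertex_mul_vertex_of_ne v w hvw := blockEnd_mul_blockEnd_of_ne v w hvw 1 1
  edge_mul_ghost v i j hi hj := by
    simp only [edgeValue_mul_ghostValue_blockFamily hQ]
    rcases eq_or_ne i j with rfl | hij
    · simp only [true_and, if_true, ← Finset.sum_filter]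
      rw [blockFamily, ← (hS v i hi).sum_mul, map_sum]
      refine Finset.sum_congr rfl fun α hα => ?_
      rw [mem_outEdges.1 (Finset.mem_filter.1 hα).1]
    · simp [hij]
  ghost_mul_edge α β := by
    simp only [ghostValue_mul_edgeValue_blockFamily hS]
    rcases eq_or_ne α β with rfl | hαβ
    · simp only [true_and, if_true, max_self]
      rw [blockFamily, ← (hQ α).sum_mul, map_sum]
      exact Finset.sum_congr rfl fun i hi => if_pos (Finset.mem_range.1 hi)
    · simp [hαβ]

theorem exists_mul_blockFamily_mul_eq_blockEnd (x : E.Gen) :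
    ∃ g h v, g * blockFamily S S' Q Q' x * h = blockEnd v v 1 := by
  rcases x with v | ⟨α, i⟩ | ⟨α, i⟩
  · exact ⟨1, 1, v, by rw [one_mul, mul_one]; rfl⟩
  all_goals
    have S'_mul_S := (hS _ i (i.2.trans_le (weight_le_maxWeight α))).mul_self α <|
      Finset.mem_filter.2 ⟨mem_outEdges.2 rfl, i.2⟩
    have Q'_mul_Q := (hQ α).mul_self i (Finset.mem_range.2 i.2)
  · refine ⟨blockEnd (E.range α) (E.source α) (S' (E.source α) i α),
      blockEnd (E.range α) (E.range α) (Q α i), E.range α, ?_⟩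
    rw [blockFamily, blockEnd_mul_blockEnd, blockEnd_mul_blockEnd, ← mul_assoc, S'_mul_S, one_mul,
      Q'_mul_Q]
  · refine ⟨blockEnd (E.source α) (E.range α) (Q' α i),
      blockEnd (E.source α) (E.source α) (S (E.source α) i α), E.source α, ?_⟩
    rw [blockFamily, blockEnd_mul_blockEnd, blockEnd_mul_blockEnd, ← mul_assoc, Q'_mul_Q, one_mul,
      S'_mul_S]

end BlockFamily

namespace LeavittPathAlgebra

variable {R : Type w} [Ring R]

theorem smul_gen_ne_zero (x : E.Gen) {r : R} (hr : r ≠ 0) : r • gen R x ≠ 0 := by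
  classical
  choose! S S' hS using fun (v : E.Vertex) (i : ℕ) (hi : i < E.maxWeight v) =>
    exists_isCuntzFamily R (s := {α ∈ E.outEdges v | i < E.weight α}) <| by
      obtain ⟨α, hα, hiα⟩ := Finset.lt_sup_iff.1 hi
      exact ⟨α, Finset.mem_filter.2 ⟨hα, hiα⟩⟩
  choose Q Q' hQ using fun α : E.StEdge =>
    exists_isCuntzFamily R (s := Finset.range (E.weight α)) ⟨0, Finset.mem_range.2 (E.weight_pos α)⟩
  let φ := Module.toAddMonoidEnd (Module.End R (E.Vertex → ℕ → R)) (E.Vertex → ℕ → R)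
  have hcf (r : R) (x : E.Gen) := commute_toAddMonoidEnd r (blockFamily S S' Q Q' x)
  have hf := (isLeavittFamily_blockFamily hS hQ).map φ.toNonUnitalRingHom
  obtain ⟨g, h, v, hgh⟩ := exists_mul_blockFamily_mul_eq_blockEnd hS hQ x
  intro smul_gen_eq_zero
  have smul_apply_eq_zero (m : E.Vertex → ℕ → R) : r • blockFamily S S' Q Q' x m = 0 := by
    have map_smul_gen := lift_smul hcf hf r (gen R x)
    rw [smul_gen_eq_zero, map_zero, lift_gen] at map_smul_gen
    exact (DFunLike.congr_fun map_smul_gen m).symm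
  let m : E.Vertex → ℕ → R := Pi.single v 1
  have smul_m_eq_zero : r • blockEnd (R := R) v v 1 m = 0 := by
    rw [← hgh, Module.End.mul_apply, Module.End.mul_apply, ← map_smul, smul_apply_eq_zero, map_zero]
  exact hr (by simpa [m, blockEnd] using congr_fun₂ smul_m_eq_zero v 0)

theorem gen_ne_zero [Nontrivial R] (x : E.Gen) : gen R x ≠ 0 := by
  simpa using smul_gen_ne_zero x (one_ne_zero (α := R))

end LeavittPathAlgebra

open LeavittPathAlgebra

section Necessity

variable {R : Type w} [Ring R]

theorem nonempty_vertex_of_nontrivial (h : Nontrivial (E.LeavittPathAlgebra R)) :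
    Nonempty E.Vertex := by
  by_contra! isEmpty_vertex
  have : IsEmpty E.Gen := ⟨fun x => isEmptyElim x.src⟩
  have eq_zero (a : E.LeavittPathAlgebra R) : a = 0 := by
    induction a using induction_on with
    | add a b ha hb => rw [ha, hb, add_zero]
    | smul r a ha => rw [ha, smul_zero]
    | gen x => exact isEmptyElim x
    | gen_mul x => exact isEmptyElim x
    | zero => rfl
  obtain ⟨a, b, hab⟩ := h
  exact hab ((eq_zero a).trans (eq_zero b).symm)

variable (h : IsRingDomain (E.LeavittPathAlgebra R))

include h

theorem isDomain_of_isRingDomain : IsDomain R := by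
  have := h.1
  obtain ⟨v⟩ := nonempty_vertex_of_nontrivial h.1
  have : Nontrivial R := Module.nontrivial R (E.LeavittPathAlgebra R)
  have : NoZeroDivisors R := by
    refine ⟨fun {a b} hab => ?_⟩
    by_contra! hne
    have smul_mul_smul_eq_zero : a • LeavittPathAlgebra.gen R (.vertex v) *
        b • LeavittPathAlgebra.gen R (.vertex v) = 0 := by
      rw [smul_mul_assoc, gen_mul_smul, smul_smul, hab, zero_smul]
    exact (h.2 _ _ smul_mul_smul_eq_zero).elim (smul_gen_ne_zero _ hne.1) (smul_gen_ne_zero _ hne.2)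
  exact NoZeroDivisors.to_isDomain R

theorem isRose_of_isRingDomain : E.IsRose := by
  have := isDomain_of_isRingDomain h
  refine Nat.card_eq_one_iff_unique.2 ⟨⟨fun v w => ?_⟩, nonempty_vertex_of_nontrivial h.1⟩
  by_contra hvw
  exact (h.2 _ _ ((isLeavittFamily_gen E R).vertex_mul_vertex_of_ne v w hvw)).elim (gen_ne_zero _)
    (gen_ne_zero _)

theorem eq_of_weight_eq_one {α : E.StEdge} (hα : E.weight α = 1) (β : E.StEdge) : α = β := by
  have := isDomain_of_isRingDomain h
  by_contra hαβ
  have ghost_mul_edge := (isLeavittFamily_gen E R).ghost_mul_edge α β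
  rw [if_neg hαβ, Finset.sum_eq_single_of_mem 0 (by simp [hα]) fun i _ hi => by
      rw [ghostValue_of_le _ (by lia), zero_mul],
    edgeValue_of_lt _ (E.weight_pos β), ghostValue_of_lt _ (E.weight_pos α)] at ghost_mul_edge
  exact (h.2 _ _ ghost_mul_edge).elim (gen_ne_zero _) (gen_ne_zero _)

theorem two_le_card_of_isRingDomain {v : E.Vertex} (hv : 2 ≤ E.maxWeight v) :
    2 ≤ ((E.outEdges v).filter fun α => E.weight α = E.maxWeight v).card := by
  have := isDomain_of_isRingDomain h
  obtain ⟨γ, hγ, -⟩ := Finset.lt_sup_iff.1 (Nat.zero_lt_of_lt hv)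
  obtain ⟨α, hα, hmax⟩ := (E.outEdges v).exists_mem_eq_sup ⟨γ, hγ⟩ E.weight
  change E.maxWeight v = E.weight α at hmax
  by_contra! card_lt
  have weight_lt (β : E.StEdge) (hβ : β ∈ E.outEdges v) (hβα : β ≠ α) :
      E.weight β < E.maxWeight v := by
    refine lt_of_le_of_ne (Finset.le_sup (f := E.weight) hβ) fun hβmax => hβα ?_
    exact Finset.card_le_one.1 (Nat.le_of_lt_succ card_lt) β (Finset.mem_filter.2 ⟨hβ, hβmax⟩) α
      (Finset.mem_filter.2 ⟨hα, hmax.symm⟩)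
  have edge_mul_ghost := (isLeavittFamily_gen E R).edge_mul_ghost v (E.maxWeight v - 1) 0 (by lia)
    (by lia)
  rw [if_neg (by lia), Finset.sum_eq_single_of_mem α hα fun β hβ hβα => by
      have := weight_lt β hβ hβα
      rw [edgeValue_of_le _ (by lia), zero_mul],
    edgeValue_of_lt _ (by lia), ghostValue_of_lt _ (by lia)] at edge_mul_ghost
  exact (h.2 _ _ edge_mul_ghost).elim (gen_ne_zero _) (gen_ne_zero _)

theorem isUnweighted_or_isLVRose_of_isRingDomain :
    (E.IsRose ∧ E.IsUnweighted ∧ Subsingleton E.StEdge) ∨ E.IsLVRose := by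
  have isRose := isRose_of_isRingDomain h
  obtain ⟨_, nonempty_vertex⟩ := Nat.card_eq_one_iff_unique.1 isRose
  by_cases hweight : ∃ α, E.weight α = 1
  · obtain ⟨α, hα⟩ := hweight
    have eq_α (β : E.StEdge) : α = β := eq_of_weight_eq_one h hα β
    exact .inl ⟨isRose, fun β => eq_α β ▸ hα, ⟨fun β γ => (eq_α β).symm.trans (eq_α γ)⟩⟩
  rcases isEmpty_or_nonempty E.StEdge with _ | nonempty_stEdge
  · exact .inl ⟨isRose, isEmptyElim, inferInstance⟩
  have two_le_weight (α : E.StEdge) : 2 ≤ E.weight α :=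
    lt_of_le_of_ne (E.weight_pos α) fun hα => hweight ⟨α, hα.symm⟩
  refine .inr ⟨⟨nonempty_stEdge, ⟨nonempty_vertex, fun v w => ?_⟩, two_le_weight, fun v hv => ?_⟩,
    isRose⟩
  · rw [Subsingleton.elim v w]
    exact .refl
  · simp only [IsSink, not_forall, not_not] at hv
    obtain ⟨γ, rfl⟩ := hv
    exact two_le_card_of_isRingDomain h ((two_le_weight γ).trans (weight_le_maxWeight γ))

end Necessity

theorem isRingDomain_of_isLVRose {R : Type w} [Ring R] [IsDomain R] (h : E.IsLVRose) :
    IsRingDomain (E.LeavittPathAlgebra R) := by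
  obtain ⟨isLVGraph, isRose⟩ := h
  obtain ⟨_, ⟨v⟩⟩ := Nat.card_eq_one_iff_unique.1 isRose
  obtain ⟨γ⟩ := isLVGraph.nonempty_stEdge
  obtain ⟨α₀, hα₀, α₁, hα₁, hne⟩ := Finset.one_lt_card.1 <|
    isLVGraph.two_le_card v fun hv => hv γ (Subsingleton.elim _ _)
  exact isRingDomain_of_two_le_weight v isLVGraph.two_le_weight hne.symm
    (Finset.mem_filter.1 hα₀).2 (Finset.mem_filter.1 hα₁).2

theorem isRingDomain_leavittPathAlgebra_iff (R : Type w) [Ring R] (E : WeightedGraph.{u, v}) :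
    IsRingDomain (E.LeavittPathAlgebra R) ↔
      IsDomain R ∧ ((E.IsRose ∧ E.IsUnweighted ∧ Subsingleton E.StEdge) ∨ E.IsLVRose) := by
  refine ⟨fun h => ⟨isDomain_of_isRingDomain h, isUnweighted_or_isLVRose_of_isRingDomain h⟩, ?_⟩
  rintro ⟨_, ⟨isRose, isUnweighted, _⟩ | isLVRose⟩
  · obtain ⟨_, ⟨v⟩⟩ := Nat.card_eq_one_iff_unique.1 isRose
    exact isRingDomain_of_isUnweighted isUnweighted v
  · exact isRingDomain_of_isLVRose isLVRose

end WeightedGraph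

theorem mainTheorem4 (R : Type w) [Ring R] :
    (∀ E : WeightedGraph.{u, v},
      IsRingDomain (E.LeavittPathAlgebra R) ↔
        IsDomain R ∧ ((E.IsRose ∧ E.IsUnweighted ∧ Subsingleton E.StEdge) ∨ E.IsLVRose)) ∧
    (∀ n k : ℕ, IsDomain R → 2 ≤ n → IsDomain (LeavittAlgebra R n (n + k))) :=
  ⟨WeightedGraph.isRingDomain_leavittPathAlgebra_iff R, fun n k _ hn =>
    LeavittAlgebra.isDomain R n (n + k) hn (hn.trans (Nat.le_add_right n k))⟩
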